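/- Setting. A reservoir distribution is a Borel probability measure $\mu$ on $[0,1]$; write $G_\mu(\tau)=\mu(\{p: p\le\tau\})$ and $G_\mu^{-1}(q)=\inf\{\tau\in\mathbb R: G_\mu(\tau)\ge q\}$. There are countably many arms $a_1,a_2,\dots$ whose mean rewards $p_1,p_2,\dots$ are drawn i.i.d. from $\mu$ and are not observed. An $N$-sample algorithm is a (possibly randomized) adaptive procedure that, for $t=1,\dots,N$, chooses an arm $a_{i_t}$ on the basis of the previously chosen arms and observed rewards (and its own randomness), observes a reward $r_t\in\{0,1\}$ that is Bernoulli with mean $p_{i_t}$ given $(p_i)_i$ and the past, and after exactly $N$ samples outputs an arm $a_{i^*}$ on the basis of all observed data (and its own randomness). The algorithm may depend on $\mu$ and $N$. For $0<\beta<\alpha<1$ let $$c_{\alpha,\beta}=\frac{\big(\arccos(1-2\alpha)-\arccos(1-2\beta)\big)^2}{2}=\frac12\left(\int_\beta^\alpha\frac{dx}{\sqrt{x(1-x)}}\right)^2,$$ that is, half the squared Fisher-information distance between $\alpha$ and $\beta$. Theorem. For any $0<\lambda,\eta<1$ and $0<\beta<\alpha<1$ there exists a single fixed reservoir distribution $\mu$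 (not depending on $N$) with $G_\mu^{-1}(1-\eta)=\alpha$ such that for every sequence $(\mathcal A_N)_{N\ge1}$ of $N$-sample algorithms, $$\liminf_{N\to\infty}\frac{\big(-\log\mathbb P[p_{i^*}<\beta]\big)\cdot\log^2N}{N}\le c_{\alpha,\beta}+\lambda,$$ where $\mathbb P[p_{i^*}<\beta]$ is the probability, over the draw of $(p_i)_i$, the rewards and the algorithm's randomness, that the arm output by $\mathcal A_N$ has mean less than $\beta$, and $-\log 0=+\infty$. -/

import Mathlib

open MeasureTheory ProbabilityTheory Filter unitInterval
open scoped ENNReal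

noncomputable section

namespace InfiniteBandit

/-- The cumulative distribution function `G_μ(τ) = P[p ≤ τ]` of a reservoir `μ` on `[0,1]`. -/
def reservoirCDF (μ : Measure I) (τ : ℝ) : ℝ :=
  μ.real {p : I | (p : ℝ) ≤ τ}

/-- The left-continuous inverse `G_μ⁻¹(q) = inf {τ : G_μ(τ) ≥ q}`. -/
def reservoirQuantile (μ : Measure I) (q : ℝ) : ℝ :=
  sInf {τ : ℝ | q ≤ reservoirCDF μ τ}

/-- The Fisher information distance between `Ber(a)` and `Ber(b)`. -/
def fisherDist (a b : ℝ) : ℝ :=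
  |∫ x in a..b, 1 / Real.sqrt (x * (1 - x))|

/-- The constant `c_{α,β}`. -/
def rateConstant (α β : ℝ) : ℝ :=
  (Real.arccos (1 - 2 * α) - Real.arccos (1 - 2 * β)) ^ 2 / 2

/-- The observed history of a run: the pairs (sampled arm, reward) seen so far, the most recent
one at the head of the list.  The arms are indexed by `ℕ`; `true` is the reward `1` and `false`
the reward `0`. -/
abbrev History : Type := List (ℕ × Bool)

/-- A (possibly randomized, adaptive) pure exploration algorithm.  Given the history of all
samples so far, `sample` is the distribution of the next arm to be sampled; given the history at
the end of the sampling phase, `output` is the distribution of the arm that is output. -/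
structure Algorithm where
  sample : History → PMF ℕ
  output : History → PMF ℕ

/-- The Bernoulli reward of mean `p`. -/
def reward (p : I) : PMF Bool :=
  (bernoulliMeasure true false p).toPMF

/-- The law of the history after exactly `t` samples, when arm `i` has mean reward `p i`. -/
def historyLaw (A : Algorithm) (p : ℕ → I) : ℕ → PMF History
  | 0 => PMF.pure []
  | t + 1 =>
    (historyLaw A p t).bind fun h =>
      (A.sample h).bind fun i =>
        (reward (p i)).map fun r => (i, r) :: h

/-- The law of the output arm `i*` of `A` run for exactly `N` samples, when arm `i` has mean
reward `p i`. -/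
def outputLaw (A : Algorithm) (N : ℕ) (p : ℕ → I) : PMF ℕ :=
  (historyLaw A p N).bind A.output

lemma reward_apply_true (p : I) : reward p true = ENNReal.ofReal p := by
  rw [reward, Measure.toPMF_apply,
    bernoulliMeasure_apply_of_mem_of_notMem p (MeasurableSet.singleton _) (by simp) (by simp)]
  rw [ENNReal.ofReal, ENNReal.coe_inj]
  ext
  simp [p.2.1]

lemma reward_apply_false (p : I) : reward p false = ENNReal.ofReal (1 - p) := by
  rw [reward, Measure.toPMF_apply,
    bernoulliMeasure_apply_of_notMem_of_mem p (MeasurableSet.singleton _) (by simp) (by simp)]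
  rw [ENNReal.ofReal, ENNReal.coe_inj]
  ext
  simp [p.2.2]

lemma measurable_reward (b : Bool) : Measurable fun p : I => reward p b := by
  cases b
  · simp only [reward_apply_false]; fun_prop
  · simp only [reward_apply_true]; fun_prop

lemma measurable_historyLaw (A : Algorithm) (t : ℕ) :
    ∀ h : History, Measurable fun p : ℕ → I => historyLaw A p t h := by
  induction t with
  | zero => intro h; simp only [historyLaw]; exact measurable_const
  | succ t ih =>
    intro h
    simp only [historyLaw, PMF.bind_apply, PMF.map_apply]
    refine Measurable.tsum fun g => (ih g).mul ?_
    refine Measurable.tsum fun i => measurable_const.mul ?_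
    refine Measurable.tsum fun r => ?_
    split_ifs
    · exact (measurable_reward r).comp (measurable_pi_apply i)
    · exact measurable_const

lemma measurable_outputLaw (A : Algorithm) (N : ℕ) :
    Measurable fun p : ℕ → I => (outputLaw A N p).toMeasure := by
  refine Measure.measurable_of_measurable_coe _ fun s hs => ?_
  simp only [PMF.toMeasure_apply _ hs]
  refine Measurable.tsum fun i => ?_
  by_cases hi : i ∈ s
  · simp only [Set.indicator_of_mem hi, outputLaw, PMF.bind_apply]
    exact Measurable.tsum fun h => (measurable_historyLaw A N h).mul measurable_const
  · simp only [Set.indicator_of_notMem hi]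
    exact measurable_const

/-- The law of the output arm as a Markov kernel in the sequence of mean rewards. -/
def outputKernel (A : Algorithm) (N : ℕ) : Kernel (ℕ → I) ℕ where
  toFun p := (outputLaw A N p).toMeasure
  measurable' := measurable_outputLaw A N

instance (A : Algorithm) (N : ℕ) : IsMarkovKernel (outputKernel A N) :=
  ⟨fun p => PMF.toMeasure.isProbabilityMeasure (outputLaw A N p)⟩

/-- The joint law of the mean rewards `(p_i)`, i.i.d. from the reservoir `μ`, and of the output
arm `i*` of `A` after exactly `N` samples. -/
def runLaw (μ : Measure I) (A : Algorithm) (N : ℕ) : Measure ((ℕ → I) × ℕ) :=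
  Measure.infinitePi (fun _ : ℕ => μ) ⊗ₘ outputKernel A N

/-- The failure probability `P[p_{i*} < β]`. -/
def failureProb (μ : Measure I) (A : Algorithm) (N : ℕ) (β : ℝ) : ℝ≥0∞ :=
  runLaw μ A N {ω | (ω.1 ω.2 : ℝ) < β}

end InfiniteBandit

end

/-! The reservoir is `(1 - w) δ_α + w Unif[0, a]` with `a` slightly above `α`. Its uniform part
makes almost any data of an arm compatible with a mean close to the empirical one, so the observed
means may all sink slowly until every arm that was sampled often looks worse than `β`. What has to
be bounded is the price per sample.

Under the uniform mixture the rewards of one arm form a Pólya urn, and in the variance-stabilizing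
coordinate `angle` the `n`-th sample moves the posterior mean by about `1/n` times a standardized
variable. Staying below a boundary that sinks by `D/n` at step `n` costs a factor of about `1 -
D²/2` per sample. With `D = d'/log N` the harmonic sum of the drifts is about `d'`, which is taken
just above `angle α - angle β`. The total price is the exponent `N d'² / (2 log² N)`, however the
samples are distributed among the arms.

To make this rigorous for adaptive algorithms, a function `F S k` of the counts of a single arm is
built with `F 0 0 = 1`, `ρ F S k ≤ F (S+1) k + F S (k+1)`, `F` at most the mixture likelihood, and
`c F` at most the part of that likelihood coming from means below `β`. Products of `F` over the arms
then give failure probability at least `c ρ ^ N` for every algorithm (`mul_pow_le_failureProb`).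

In the main phase `F` is a small prefactor times `uniformMix` times a profile `U` of the scaled
distance to the boundary. The recursion becomes, to leading order, `U'' + 2 U' + (1 + lam) U ≥ 0`,
which a wide Gaussian cut off at a small level satisfies (`exists_gaussian_step`,
`exists_profile_step`, `exists_urn_step`). The support of `U` keeps the empirical mean below `a`,
where the reservoir dominates the prefactor times `uniformMix` (`ofReal_mul_uniformMix_le`). A
polylogarithmic warm-up starts from the true mixture, discards high empirical means by Chebyshev's
inequality, and spends half of the loss per sample on paying for the prefactor, which is of order
`1/N`. An arm with at most `T ≈ N/log³ N` samples need not look bad: its data have likelihood at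
least `(β/4)^T` for means in a window below `β`, a negligible cost. -/

noncomputable section

namespace InfiniteBandit

/-! ### Reduction to a one-arm subsolution -/

/-- The likelihood of `S` successes and `k` failures for an arm of mean `x`. -/
def armLik (x : I) (S k : ℕ) : ℝ≥0∞ := reward x true ^ S * reward x false ^ k

lemma measurable_armLik (S k : ℕ) : Measurable fun x : I => armLik x S k :=
  ((measurable_reward true).pow_const S).mul ((measurable_reward false).pow_const k)

lemma armLik_zero (x : I) : armLik x 0 0 = 1 := by simp [armLik]

/-- The probability that the algorithm chooses the arms listed in the history, given the
rewards listed there. -/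
def algWeight (A : Algorithm) : History → ℝ≥0∞
  | [] => 1
  | x :: h => algWeight A h * A.sample h x.1

/-- The probability of the rewards listed in the history, given the arms listed there. -/
def rewardWeight (p : ℕ → I) (h : History) : ℝ≥0∞ :=
  (h.map fun x => reward (p x.1) x.2).prod

/-- A lower bound on failure needs only this direction, so each sum over predecessors may be cut
down to a single term. -/
lemma algWeight_mul_rewardWeight_le (A : Algorithm) (p : ℕ → I) (h : History) :
    algWeight A h * rewardWeight p h ≤ historyLaw A p h.length h := by
  induction h with
  | nil => simp [algWeight, rewardWeight, historyLaw]
  | cons x g ih =>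
    obtain ⟨i, r⟩ := x
    simp only [List.length_cons, historyLaw, PMF.bind_apply, PMF.map_apply]
    refine le_trans ?_ (ENNReal.le_tsum g)
    have h1 : A.sample g i * reward (p i) r ≤
        ∑' j, A.sample g j * ∑' s, if (i, r) :: g = (j, s) :: g then reward (p j) s else 0 := by
      refine le_trans ?_ (ENNReal.le_tsum i)
      gcongr
      refine le_trans ?_ (ENNReal.le_tsum r)
      simp
    calc algWeight A ((i, r) :: g) * rewardWeight p ((i, r) :: g)
        = algWeight A g * rewardWeight p g * (A.sample g i * reward (p i) r) := by
          simp only [algWeight, rewardWeight, List.map_cons, List.prod_cons]; ring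
      _ ≤ _ := (mul_le_mul' ih h1).trans (le_of_eq (by congr! 6; split_ifs <;> rfl))

/-- The arms that occur in a history. -/
def arms (h : History) : Finset ℕ := (h.map Prod.fst).toFinset

lemma count_eq_zero_of_notMem_arms {h : History} {j : ℕ} (hj : j ∉ arms h) (b : Bool) :
    h.count (j, b) = 0 := by
  rw [List.count_eq_zero]
  intro hm
  exact hj (by simp only [arms, List.mem_toFinset, List.mem_map]; exact ⟨_, hm, rfl⟩)

lemma count_add_count_le (h : History) (j : ℕ) :
    h.count (j, true) + h.count (j, false) ≤ h.length := by
  induction h with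
  | nil => simp
  | cons x g ih =>
    obtain ⟨i, r⟩ := x
    simp only [List.count_cons, List.length_cons]
    by_cases hi : i = j <;> cases r <;> simp [hi] <;> omega

/-- The product over the arms of a function of their numbers of successes and failures. -/
def armProd (F : ℕ → ℕ → ℝ≥0∞) (h : History) : ℝ≥0∞ :=
  ∏ j ∈ arms h, F (h.count (j, true)) (h.count (j, false))

lemma armProd_eq_prod {F : ℕ → ℕ → ℝ≥0∞} (hF : F 0 0 = 1) {h : History} {s : Finset ℕ}
    (hs : arms h ⊆ s) :
    armProd F h = ∏ j ∈ s, F (h.count (j, true)) (h.count (j, false)) := by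
  refine Finset.prod_subset hs fun j _ hj => ?_
  rw [count_eq_zero_of_notMem_arms hj, count_eq_zero_of_notMem_arms hj, hF]

lemma rewardWeight_eq_prod (p : ℕ → I) {h : History} {s : Finset ℕ} (hs : arms h ⊆ s) :
    rewardWeight p h = ∏ j ∈ s, armLik (p j) (h.count (j, true)) (h.count (j, false)) := by
  induction h with
  | nil => simp [rewardWeight, armLik]
  | cons x g ih =>
    obtain ⟨i, r⟩ := x
    have hi : i ∈ s := hs (by simp [arms])
    have hg : arms g ⊆ s := fun j hj => hs (by simp only [arms] at hj ⊢; simp_all)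
    have h2 : rewardWeight p ((i, r) :: g) = reward (p i) r * rewardWeight p g := by
      simp [rewardWeight]
    rw [h2, ih hg, ← Finset.mul_prod_erase s _ hi, ← Finset.mul_prod_erase s _ hi, ← mul_assoc]
    congr 1
    · cases r <;> simp [armLik, pow_succ] <;> ring
    · refine Finset.prod_congr rfl fun j hj => ?_
      have hne : i ≠ j := (Finset.ne_of_mem_erase hj).symm
      simp [hne]

/-- The histories of length `N` carry total weight at least `ρ ^ N` under a subsolution. -/
lemma pow_le_tsum_algWeight_mul_armProd (A : Algorithm) {F : ℕ → ℕ → ℝ≥0∞} (hF : F 0 0 = 1)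
    {ρ : ℝ≥0∞} {N : ℕ}
    (hstep : ∀ S k, S + k < N → ρ * F S k ≤ F (S + 1) k + F S (k + 1)) {t : ℕ} (ht : t ≤ N) :
    ρ ^ t ≤ ∑' h : History, if h.length = t then algWeight A h * armProd F h else 0 := by
  induction t with
  | zero =>
    refine le_trans ?_ (ENNReal.le_tsum ([] : History))
    simp [algWeight, armProd, arms]
  | succ t ih =>
    have hinj : Function.Injective
        fun y : History × (ℕ × Bool) => (y.2 :: y.1 : History) := by
      rintro ⟨g, x⟩ ⟨g', x'⟩ h
      simpa [and_comm] using h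
    refine le_trans ?_ (ENNReal.tsum_comp_le_tsum_of_injective hinj _)
    rw [ENNReal.tsum_prod']
    rw [pow_succ]
    refine le_trans (mul_le_mul_left (ih (by omega)) ρ) ?_
    rw [← ENNReal.tsum_mul_right]
    refine ENNReal.tsum_le_tsum fun g => ?_
    by_cases hg : g.length = t
    swap
    · simp [hg]
    simp only [hg, if_true, List.length_cons]
    rw [ENNReal.tsum_prod']
    -- Sampling arm `i` changes only its own factor, so one use of `hstep` suffices whatever arm is
    -- chosen; this is why adaptivity does not help the algorithm.
    have key : ∀ i : ℕ, A.sample g i * (algWeight A g * armProd F g * ρ) ≤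
        ∑' b, algWeight A ((i, b) :: g) * armProd F ((i, b) :: g) := by
      intro i
      rw [tsum_bool]
      set s := insert i (arms g)
      have hi : i ∈ s := Finset.mem_insert_self _ _
      have hb : ∀ b, arms ((i, b) :: g) ⊆ s := fun b j hj => by
        simp only [arms, s] at hj ⊢; simp_all
      have hsplit : ∀ b, armProd F ((i, b) :: g) =
          F (((i, b) :: g).count (i, true)) (((i, b) :: g).count (i, false)) *
          ∏ j ∈ s.erase i, F (g.count (j, true)) (g.count (j, false)) := by
        intro b
        rw [armProd_eq_prod hF (hb b), ← Finset.mul_prod_erase s _ hi]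
        congr 1
        refine Finset.prod_congr rfl fun j hj => ?_
        have hne : i ≠ j := (Finset.ne_of_mem_erase hj).symm
        simp [hne]
      rw [hsplit, hsplit, armProd_eq_prod hF (Finset.subset_insert i (arms g)),
        ← Finset.mul_prod_erase s _ hi]
      have hst := hstep (g.count (i, true)) (g.count (i, false))
        (lt_of_le_of_lt (count_add_count_le g i) (by omega))
      simp only [algWeight]
      simp only [List.count_cons, beq_iff_eq, Prod.mk.injEq, true_and, if_true,
        Bool.false_eq_true, Bool.true_eq_false, if_false, add_zero]
      set Q := ∏ j ∈ s.erase i, F (g.count (j, true)) (g.count (j, false))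
      calc A.sample g i * (algWeight A g * (F (g.count (i, true)) (g.count (i, false)) * Q) * ρ)
          = algWeight A g * A.sample g i * Q *
            (ρ * F (g.count (i, true)) (g.count (i, false))) := by ring
        _ ≤ algWeight A g * A.sample g i * Q *
            (F (g.count (i, true) + 1) (g.count (i, false)) +
              F (g.count (i, true)) (g.count (i, false) + 1)) := by gcongr
        _ = _ := by ring
    calc algWeight A g * armProd F g * ρ
        = ∑' i, A.sample g i * (algWeight A g * armProd F g * ρ) := by
          rw [ENNReal.tsum_mul_right, PMF.tsum_coe, one_mul]
      _ ≤ _ := ENNReal.tsum_le_tsum key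

lemma measurableSet_failure (β : ℝ) :
    MeasurableSet {ω : (ℕ → I) × ℕ | (ω.1 ω.2 : ℝ) < β} := by
  have : Measurable fun ω : (ℕ → I) × ℕ => ω.1 ω.2 :=
    measurable_from_prod_countable_left fun i => measurable_pi_apply i
  exact measurableSet_lt (measurable_subtype_coe.comp this) measurable_const

lemma lintegral_infinitePi_prod (μ : Measure I) [IsProbabilityMeasure μ] (s : Finset ℕ)
    (φ : ℕ → I → ℝ≥0∞) (hφ : ∀ j, Measurable (φ j)) :
    ∫⁻ p, ∏ j ∈ s, φ j (p j) ∂(Measure.infinitePi fun _ : ℕ => μ) = ∏ j ∈ s, ∫⁻ x, φ j x ∂μ := by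
  have h := lintegral_prod_eq_prod_lintegral_of_indepFun s (fun j (p : ℕ → I) => φ j (p j))
    (iIndepFun_infinitePi (P := fun _ => μ) hφ) fun j => (hφ j).comp (measurable_pi_apply j)
  rw [h]
  refine Finset.prod_congr rfl fun j _ => ?_
  exact (measurePreserving_eval_infinitePi (fun _ : ℕ => μ) j).lintegral_comp (hφ j)

/-- Integrating out the independent means factorizes the weight of a history over the arms. The
factor of the output arm is bounded by `hfail`, all others by `hle`. -/
theorem mul_pow_le_failureProb (μ : Measure I) [IsProbabilityMeasure μ] (A : Algorithm)
    (N : ℕ) (β : ℝ) {F : ℕ → ℕ → ℝ≥0∞} {ρ c : ℝ≥0∞} (hF : F 0 0 = 1)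
    (hstep : ∀ S k, S + k < N → ρ * F S k ≤ F (S + 1) k + F S (k + 1))
    (hle : ∀ S k, S + k ≤ N → F S k ≤ ∫⁻ x, armLik x S k ∂μ)
    (hfail : ∀ S k, S + k ≤ N → c * F S k ≤ ∫⁻ x in {x : I | (x : ℝ) < β}, armLik x S k ∂μ) :
    c * ρ ^ N ≤ failureProb μ A N β := by
  classical
  have hBs : MeasurableSet {x : I | (x : ℝ) < β} :=
    measurableSet_lt measurable_subtype_coe measurable_const
  have hker : ∀ p : ℕ → I,
      ∑' h : History, ∑' i, (if h.length = N then algWeight A h * A.output h i *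
        (rewardWeight p h * (if (p i : ℝ) < β then 1 else 0)) else 0) ≤
      outputKernel A N p (Prod.mk p ⁻¹' {ω : (ℕ → I) × ℕ | (ω.1 ω.2 : ℝ) < β}) := by
    intro p
    have : outputKernel A N p = (outputLaw A N p).toMeasure := rfl
    rw [this, PMF.toMeasure_apply _ (.of_discrete), ENNReal.tsum_comm]
    refine ENNReal.tsum_le_tsum fun i => ?_
    by_cases hi : (p i : ℝ) < β
    · rw [Set.indicator_of_mem (by simpa using hi), outputLaw, PMF.bind_apply]
      refine ENNReal.tsum_le_tsum fun h => ?_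
      split_ifs with hl
      · subst hl
        calc _ = algWeight A h * rewardWeight p h * A.output h i := by ring
          _ ≤ _ := by gcongr; exact algWeight_mul_rewardWeight_le A p h
      · simp
    · simp [hi]
  rw [failureProb, runLaw, Measure.compProd_apply (measurableSet_failure β)]
  refine le_trans ?_ (lintegral_mono hker)
  have hmeas : ∀ (h : History) (i : ℕ), Measurable fun p : ℕ → I =>
      (if h.length = N then algWeight A h * A.output h i *
        (rewardWeight p h * (if (p i : ℝ) < β then 1 else 0)) else 0 : ℝ≥0∞) := by
    intro h i
    split_ifs
    · refine measurable_const.mul (Measurable.mul ?_ ?_)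
      · simp only [rewardWeight_eq_prod _ (subset_refl (arms h))]
        exact Finset.measurable_prod _ fun j _ =>
          (measurable_armLik _ _).comp (measurable_pi_apply j)
      · exact Measurable.ite (measurableSet_lt
          (measurable_subtype_coe.comp (measurable_pi_apply i)) measurable_const)
          measurable_const measurable_const
    · exact measurable_const
  rw [lintegral_tsum fun h => (Measurable.tsum fun i => hmeas h i).aemeasurable]
  calc c * ρ ^ N
      ≤ c * ∑' h : History, if h.length = N then algWeight A h * armProd F h else 0 := by
        gcongr
        exact pow_le_tsum_algWeight_mul_armProd A hF hstep le_rfl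
    _ = ∑' h : History, c * if h.length = N then algWeight A h * armProd F h else 0 :=
        ENNReal.tsum_mul_left.symm
    _ ≤ _ := ENNReal.tsum_le_tsum fun h => ?_
  rw [lintegral_tsum fun i => (hmeas h i).aemeasurable]
  by_cases hl : h.length = N
  swap
  · simp [hl]
  simp only [hl, if_true]
  have key : ∀ i, A.output h i * (c * (algWeight A h * armProd F h)) ≤
      ∫⁻ p, algWeight A h * A.output h i *
        (rewardWeight p h * (if (p i : ℝ) < β then 1 else 0))
        ∂(Measure.infinitePi fun _ : ℕ => μ) := by
    intro i
    -- The output arm may never have been sampled. Its factor is then `F 0 0 = 1`, and it still has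
    -- to pay `c`.
    set s := insert i (arms h)
    have hi : i ∈ s := Finset.mem_insert_self _ _
    have hs : arms h ⊆ s := Finset.subset_insert _ _
    set φ : ℕ → I → ℝ≥0∞ := fun j x => armLik x (h.count (j, true)) (h.count (j, false)) *
      if j = i then (if (x : ℝ) < β then 1 else 0) else 1
    have hφ : ∀ j, Measurable (φ j) := by
      intro j
      refine (measurable_armLik _ _).mul ?_
      split_ifs
      · exact Measurable.ite hBs measurable_const measurable_const
      · exact measurable_const
    have hprod : ∀ p : ℕ → I, rewardWeight p h * (if (p i : ℝ) < β then 1 else 0) =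
        ∏ j ∈ s, φ j (p j) := by
      intro p
      rw [rewardWeight_eq_prod p hs, Finset.prod_mul_distrib]
      congr 1
      rw [Finset.prod_ite_eq' s i, if_pos hi]
    simp only [hprod]
    have hm : Measurable fun p : ℕ → I => ∏ j ∈ s, φ j (p j) :=
      Finset.measurable_prod _ fun j _ => (hφ j).comp (measurable_pi_apply j)
    rw [lintegral_const_mul _ hm, lintegral_infinitePi_prod μ s φ hφ]
    have hc : c * armProd F h ≤ ∏ j ∈ s, ∫⁻ x, φ j x ∂μ := by
      rw [armProd_eq_prod hF hs, ← Finset.mul_prod_erase s _ hi, ← Finset.mul_prod_erase s _ hi,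
        ← mul_assoc]
      have hN : ∀ j, h.count (j, true) + h.count (j, false) ≤ N := fun j =>
        hl ▸ count_add_count_le h j
      refine mul_le_mul' ?_ (Finset.prod_le_prod' fun j hj => ?_)
      · refine (hfail _ _ (hN i)).trans (le_of_eq ?_)
        rw [← lintegral_indicator hBs]
        refine lintegral_congr fun x => ?_
        by_cases hx : (x : ℝ) < β
        · rw [Set.indicator_of_mem (by exact hx)]; simp [φ, hx]
        · rw [Set.indicator_of_notMem (by exact hx)]; simp [φ, hx]
      · refine (hle _ _ (hN j)).trans (le_of_eq ?_)
        refine lintegral_congr fun x => ?_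
        simp [φ, Finset.ne_of_mem_erase hj]
    calc A.output h i * (c * (algWeight A h * armProd F h))
        = algWeight A h * A.output h i * (c * armProd F h) := by ring
      _ ≤ _ := by gcongr
  calc c * (algWeight A h * armProd F h)
      = ∑' i, A.output h i * (c * (algWeight A h * armProd F h)) := by
        rw [ENNReal.tsum_mul_right, PMF.tsum_coe, one_mul]
    _ ≤ _ := ENNReal.tsum_le_tsum key

/-! ### Bernoulli likelihoods and the uniform mixture -/

/-- The real-valued likelihood of `S` successes and `k` failures under mean `x`. -/
def likelihood (x : ℝ) (S k : ℕ) : ℝ := x ^ S * (1 - x) ^ k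

/-- The uniform mixture `∫₀¹ x ^ S (1 - x) ^ k dx`. -/
def uniformMix (S k : ℕ) : ℝ := (S.factorial * k.factorial : ℝ) / (S + k + 1).factorial

lemma uniformMix_pos (S k : ℕ) : 0 < uniformMix S k := by unfold uniformMix; positivity

/-- Laplace's rule of succession: the next reward is a success with probability `(S+1)/(S+k+2)`,
which is the transition of the urn in the main phase. -/
lemma uniformMix_succ_left (S k : ℕ) :
    uniformMix (S + 1) k = uniformMix S k * ((S + 1 : ℝ) / (S + k + 2)) := by
  unfold uniformMix
  rw [show S + 1 + k + 1 = (S + k + 1) + 1 by ring, Nat.factorial_succ, Nat.factorial_succ]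
  push_cast
  field_simp
  ring

lemma uniformMix_succ_right (S k : ℕ) :
    uniformMix S (k + 1) = uniformMix S k * (1 - (S + 1 : ℝ) / (S + k + 2)) := by
  unfold uniformMix
  rw [show S + (k + 1) + 1 = (S + k + 1) + 1 by ring, Nat.factorial_succ (S + k + 1),
    Nat.factorial_succ k]
  push_cast
  field_simp
  ring

lemma continuous_likelihood (S k : ℕ) : Continuous fun x : ℝ => likelihood x S k := by
  unfold likelihood; fun_prop

lemma likelihood_nonneg {x : ℝ} (h0 : 0 ≤ x) (h1 : x ≤ 1) (S k : ℕ) : 0 ≤ likelihood x S k :=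
  mul_nonneg (pow_nonneg h0 _) (pow_nonneg (by linarith) _)

lemma armLik_eq_ofReal (x : I) (S k : ℕ) : armLik x S k = ENNReal.ofReal (likelihood x S k) := by
  have h1 : (0 : ℝ) ≤ 1 - x := by linarith [x.2.2]
  rw [armLik, reward_apply_true, reward_apply_false, likelihood,
    ENNReal.ofReal_mul (pow_nonneg x.2.1 _), ENNReal.ofReal_pow x.2.1, ENNReal.ofReal_pow h1]

/-- The Beta integral; integration by parts trades one success for one failure. -/
lemma integral_likelihood (S k : ℕ) : ∫ x in (0 : ℝ)..1, likelihood x S k = uniformMix S k := by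
  induction S generalizing k with
  | zero =>
    have h : ∀ x : ℝ, HasDerivAt (fun y : ℝ => -(1 - y) ^ (k + 1) / (k + 1)) (likelihood x 0 k) x := by
      intro x
      have := ((((hasDerivAt_id x).const_sub 1).pow (k + 1)).neg).div_const ((k : ℝ) + 1)
      refine this.congr_deriv ?_
      simp only [likelihood, id, Nat.add_sub_cancel]
      push_cast
      field_simp
    rw [intervalIntegral.integral_eq_sub_of_hasDerivAt (fun x _ => h x)
      ((continuous_likelihood 0 k).intervalIntegrable _ _)]
    simp only [uniformMix, Nat.factorial_zero, zero_add, Nat.factorial_succ]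
    push_cast
    field_simp
    simp
  | succ S ih =>
    have h : ∀ x : ℝ, HasDerivAt (fun y : ℝ => -(y ^ (S + 1) * (1 - y) ^ (k + 1)) / (k + 1))
        (likelihood x (S + 1) k - (S + 1) / (k + 1) * likelihood x S (k + 1)) x := by
      intro x
      have := ((((hasDerivAt_id x).pow (S + 1)).mul
        (((hasDerivAt_id x).const_sub 1).pow (k + 1))).neg).div_const ((k : ℝ) + 1)
      refine this.congr_deriv ?_
      simp only [likelihood, id, Pi.pow_apply, Nat.add_sub_cancel]
      push_cast
      field_simp
      simp
      ring
    have h2 := intervalIntegral.integral_eq_sub_of_hasDerivAt (a := 0) (b := 1) (fun x _ => h x)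
      (((continuous_likelihood (S + 1) k).sub
        ((continuous_likelihood S (k + 1)).const_mul _)).intervalIntegrable _ _)
    rw [intervalIntegral.integral_sub ((continuous_likelihood _ _).intervalIntegrable _ _)
      (((continuous_likelihood _ _).const_mul _).intervalIntegrable _ _),
      intervalIntegral.integral_const_mul, ih] at h2
    simp only [sub_self, zero_pow (Nat.succ_ne_zero _), mul_zero, zero_mul, neg_zero, zero_div]
      at h2
    rw [sub_eq_zero.mp h2, uniformMix, uniformMix, show S + (k + 1) + 1 = S + 1 + k + 1 by ring,
      Nat.factorial_succ k, Nat.factorial_succ S]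
    push_cast
    field_simp

/-- A binomial probability is at most 1, whereas the uniform mixture gives each of the `S + k + 1`
possible counts the same probability. -/
lemma likelihood_le_mul_uniformMix {x : ℝ} (h0 : 0 ≤ x) (h1 : x ≤ 1) (S k : ℕ) :
    likelihood x S k ≤ (S + k + 1) * uniformMix S k := by
  have hsum : (S + k).choose S * likelihood x S k ≤ 1 := by
    have h := add_pow x (1 - x) (S + k)
    rw [show x + (1 - x) = 1 by ring, one_pow] at h
    rw [h]
    have := Finset.single_le_sum (f := fun m => x ^ m * (1 - x) ^ (S + k - m) * ((S + k).choose m : ℝ))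
      (s := Finset.range (S + k + 1)) (fun m _ => mul_nonneg (mul_nonneg (pow_nonneg h0 _)
        (pow_nonneg (by linarith) _)) (Nat.cast_nonneg _)) (a := S) (by simp)
    refine le_trans (le_of_eq ?_) this
    simp only [likelihood, Nat.add_sub_cancel_left]
    ring
  have hc : ((S + k).choose S : ℝ) * ((S + k + 1) * uniformMix S k) = 1 := by
    rw [uniformMix, Nat.factorial_succ, Nat.cast_add_choose]
    push_cast
    field_simp
  have hpos : (0 : ℝ) < (S + k).choose S := by
    exact_mod_cast Nat.choose_pos (Nat.le_add_right S k)
  rw [← hc] at hsum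
  exact le_of_mul_le_mul_left hsum hpos

/-- The empirical mean `c` maximizes the likelihood: applying `1 + t ≤ exp t` to `x/c` and to
`(1-x)/(1-c)` produces exponents that cancel. -/
lemma likelihood_le_likelihood_div {x : ℝ} (h0 : 0 ≤ x) (h1 : x ≤ 1) {S k : ℕ} (hm : 0 < S + k) :
    likelihood x S k ≤ likelihood (S / (S + k : ℝ)) S k := by
  have hm' : (0 : ℝ) < S + k := by exact_mod_cast hm
  set c : ℝ := S / (S + k : ℝ) with hc
  have hcS : c * (S + k) = S := by rw [hc]; field_simp
  have hck : (1 - c) * (S + k) = k := by linarith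
  have hS0 : 0 ≤ c := by positivity
  have hk0 : 0 ≤ 1 - c := by
    by_contra h
    push Not at h
    have := mul_neg_of_neg_of_pos h hm'
    rw [hck] at this
    exact absurd this (not_lt.mpr (Nat.cast_nonneg k))
  have hA : x ^ S ≤ c ^ S * Real.exp ((S + k) * (x - c)) := by
    rcases Nat.eq_zero_or_pos S with hS | hS
    · have : c = 0 := by rw [hc, hS]; simp
      rw [this, hS, pow_zero, pow_zero, one_mul]
      exact Real.one_le_exp (by simp only [sub_zero]; positivity)
    · have hS' : (0 : ℝ) < S := by exact_mod_cast hS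
      have hcpos : 0 < c := by positivity
      have h2 : x ≤ c * Real.exp ((x - c) / c) := by
        have := Real.add_one_le_exp ((x - c) / c)
        calc x = c * ((x - c) / c + 1) := by field_simp; ring
          _ ≤ _ := by gcongr
      calc x ^ S ≤ (c * Real.exp ((x - c) / c)) ^ S := by gcongr
        _ = c ^ S * Real.exp ((S + k) * (x - c)) := by
          rw [mul_pow, ← Real.exp_nat_mul]
          congr 2
          nth_rewrite 1 [← hcS]; field_simp
  have hB : (1 - x) ^ k ≤ (1 - c) ^ k * Real.exp (-((S + k) * (x - c))) := by
    rcases Nat.eq_zero_or_pos k with hk | hk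
    · have : c = 1 := by
        have : (1 - c) * (S + k) = 0 := by rw [hck, hk]; simp
        rcases mul_eq_zero.mp this with h | h
        · linarith
        · linarith
      rw [this, hk, pow_zero, pow_zero, one_mul]
      refine Real.one_le_exp ?_
      have : 0 ≤ (S + (0 : ℕ) : ℝ) * (1 - x) := mul_nonneg (by positivity) (by linarith)
      linarith
    · have hk' : (0 : ℝ) < k := by exact_mod_cast hk
      have hcpos : 0 < 1 - c := by
        by_contra h
        have : (1 - c) * (S + k) ≤ 0 := mul_nonpos_of_nonpos_of_nonneg (by linarith) hm'.le
        linarith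
      have h2 : 1 - x ≤ (1 - c) * Real.exp (-(x - c) / (1 - c)) := by
        have := Real.add_one_le_exp (-(x - c) / (1 - c))
        calc 1 - x = (1 - c) * (-(x - c) / (1 - c) + 1) := by field_simp; ring
          _ ≤ _ := by gcongr
      calc (1 - x) ^ k ≤ ((1 - c) * Real.exp (-(x - c) / (1 - c))) ^ k :=
            pow_le_pow_left₀ (by linarith) h2 _
        _ = _ := by
          rw [mul_pow, ← Real.exp_nat_mul]
          congr 2
          nth_rewrite 1 [← hck]; field_simp
  calc likelihood x S k ≤ (c ^ S * Real.exp ((S + k) * (x - c))) *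
        ((1 - c) ^ k * Real.exp (-((S + k) * (x - c)))) :=
        mul_le_mul hA hB (pow_nonneg (by linarith) _) (by positivity)
    _ = c ^ S * (1 - c) ^ k * (Real.exp ((S + k) * (x - c)) *
        Real.exp (-((S + k) * (x - c)))) := by ring
    _ = likelihood c S k := by rw [← Real.exp_add, add_neg_cancel, Real.exp_zero, mul_one]; rfl

lemma uniformMix_le_likelihood_div {S k : ℕ} (hm : 0 < S + k) :
    uniformMix S k ≤ likelihood (S / (S + k : ℝ)) S k := by
  rw [← integral_likelihood]
  calc ∫ x in (0 : ℝ)..1, likelihood x S k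
      ≤ ∫ x in (0 : ℝ)..1, likelihood (S / (S + k : ℝ)) S k := by
        refine intervalIntegral.integral_mono_on zero_le_one
          ((continuous_likelihood S k).intervalIntegrable _ _) (by simp) fun x hx => ?_
        exact likelihood_le_likelihood_div hx.1 hx.2 hm
    _ = _ := by simp

/-- Just above the empirical mean the likelihood is at least half of the uniform mixture. -/
lemma half_uniformMix_le_likelihood {S k : ℕ} (hm : 0 < S + k) {x : ℝ}
    (hx : S / (S + k : ℝ) ≤ x) (hx' : x ≤ (S + 1 / 2) / (S + k : ℝ)) (hx1 : x ≤ 1) :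
    uniformMix S k / 2 ≤ likelihood x S k := by
  have hm' : (0 : ℝ) < S + k := by exact_mod_cast hm
  have h := uniformMix_le_likelihood_div hm
  set c : ℝ := S / (S + k : ℝ) with hc
  have hc0 : 0 ≤ c := by positivity
  have hck : (1 - c) * (S + k) = k := by rw [hc]; field_simp; ring
  have hxm : (x - c) * (S + k) ≤ 1 / 2 := by
    rw [le_div_iff₀ hm'] at hx'
    have : c * (S + k) = S := by rw [hc]; field_simp
    linarith
  -- Moving right of `c` only increases `x ^ S`. The failures lose at most half by Bernoulli's
  -- inequality, since `k (x - c)/(1 - c) = (S + k)(x - c) ≤ 1/2`.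
  have hpow : (1 - c) ^ k * (1 / 2) ≤ (1 - x) ^ k := by
    rcases Nat.eq_zero_or_pos k with hk | hk
    · rw [hk]; norm_num
    have hk' : (1 : ℝ) ≤ k := by exact_mod_cast hk
    have hcpos : 0 < 1 - c := by
      by_contra h
      have : (1 - c) * (S + k) ≤ 0 := mul_nonpos_of_nonpos_of_nonneg (by linarith) hm'.le
      linarith
    have h1 : 1 - x = (1 - c) * (1 + -((x - c) / (1 - c))) := by field_simp; ring
    have h2 : (x - c) / (1 - c) * k ≤ 1 / 2 := by
      rw [← hck]
      calc (x - c) / (1 - c) * ((1 - c) * (S + k)) = (x - c) * (S + k) := by field_simp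
        _ ≤ _ := hxm
    have h3 : 0 ≤ (x - c) / (1 - c) := div_nonneg (by linarith) hcpos.le
    have h4 : (x - c) / (1 - c) ≤ 1 / 2 := by nlinarith
    rw [h1, mul_pow]
    refine mul_le_mul_of_nonneg_left ?_ (by positivity)
    have := one_add_mul_le_pow (a := -((x - c) / (1 - c))) (by linarith) k
    linarith
  have h1c : 0 ≤ 1 - c := by linarith
  calc uniformMix S k / 2 ≤ c ^ S * (1 - c) ^ k / 2 := by
        have : likelihood c S k = c ^ S * (1 - c) ^ k := rfl
        linarith
    _ = c ^ S * ((1 - c) ^ k * (1 / 2)) := by ring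
    _ ≤ x ^ S * (1 - x) ^ k := mul_le_mul (pow_le_pow_left₀ hc0 hx _) hpow (by positivity)
        (pow_nonneg (hc0.trans hx) _)

/-! ### The reservoir -/

/-- An atom at `α` mixed with the uniform distribution on `[0, a]`. -/
def reservoir (α a : I) (w : ℝ) : Measure I :=
  ENNReal.ofReal (1 - w) • Measure.dirac α +
    ENNReal.ofReal (w / a) • (volume : Measure I).restrict (Set.Iic a)

section Reservoir

variable {α a : I} {w : ℝ}

lemma isProbabilityMeasure_reservoir (ha : (0 : ℝ) < a) (hw : 0 < w) (hw1 : w < 1) :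
    IsProbabilityMeasure (reservoir α a w) := by
  refine ⟨?_⟩
  simp only [reservoir, Measure.add_apply, Measure.smul_apply, measure_univ, smul_eq_mul, mul_one,
    Measure.restrict_apply_univ, unitInterval.volume_Iic]
  rw [← ENNReal.ofReal_mul (by positivity), ← ENNReal.ofReal_add (by linarith) (by positivity)]
  field_simp
  simp

lemma ofReal_mul_volume_le_reservoir {s : Set I} (hs : MeasurableSet s) (hsa : s ⊆ Set.Iic a) :
    ENNReal.ofReal (w / a) * volume s ≤ reservoir α a w s := by
  simp only [reservoir, Measure.add_apply, Measure.smul_apply, smul_eq_mul]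
  rw [Measure.restrict_apply hs, Set.inter_eq_self_of_subset_left hsa]
  exact le_add_self

lemma reservoir_Ioi_le (hw : 0 ≤ w) {c : I} (hc : α ≤ c) :
    reservoir α a w (Set.Ioi c) ≤ ENNReal.ofReal (w / a * (a - c)) := by
  simp only [reservoir, Measure.add_apply, Measure.smul_apply, smul_eq_mul]
  rw [Measure.restrict_apply measurableSet_Ioi, Measure.dirac_apply' _ measurableSet_Ioi,
    Set.indicator_of_notMem (by simpa using hc), Set.Ioi_inter_Iic, unitInterval.volume_Ioc,
    mul_zero, zero_add, ENNReal.ofReal_mul (div_nonneg hw a.2.1)]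

/-- Below `α` only the uniform part counts, with mass at most `w α/a < w ≤ 1 - η`; at `α` the atom
alone contributes `1 - w ≥ 1 - η`. -/
lemma reservoirQuantile_reservoir (hα : (0 : ℝ) < α) (hαa : α < a) {η : ℝ} (hw : 0 < w)
    (hw1 : w < 1) (hwη : w ≤ η) (hwη' : w ≤ 1 - η) :
    reservoirQuantile (reservoir α a w) (1 - η) = α := by
  have hαa' : (α : ℝ) < a := hαa
  have ha : (0 : ℝ) < a := hα.trans hαa'
  have := isProbabilityMeasure_reservoir (α := α) ha hw hw1
  have hset : {τ : ℝ | 1 - η ≤ reservoirCDF (reservoir α a w) τ} = Set.Ici (α : ℝ) := by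
    ext τ
    simp only [Set.mem_ofPred_eq, Set.mem_Ici]
    constructor
    · intro h
      by_contra hτ
      push Not at hτ
      have hle : reservoir α a w {p : I | (p : ℝ) ≤ τ} ≤ ENNReal.ofReal (w / a * α) := by
        have hms : MeasurableSet {p : I | (p : ℝ) ≤ τ} :=
          measurableSet_le measurable_subtype_coe measurable_const
        simp only [reservoir, Measure.add_apply, Measure.smul_apply, smul_eq_mul]
        rw [Measure.restrict_apply hms, Measure.dirac_apply' _ hms,
          Set.indicator_of_notMem (by simpa using hτ), mul_zero, zero_add,
          ENNReal.ofReal_mul (by positivity), ← unitInterval.volume_Iic]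
        gcongr
        intro p hp
        have : (p : ℝ) ≤ τ := hp.1
        exact Subtype.coe_le_coe.mp (this.trans hτ.le)
      have h2 : reservoirCDF (reservoir α a w) τ ≤ w / a * α :=
        ENNReal.toReal_le_of_le_ofReal (by positivity) hle
      have h3 : w / a * α < w := by
        rw [div_mul_eq_mul_div, div_lt_iff₀ ha]
        exact mul_lt_mul_of_pos_left hαa' hw
      linarith
    · intro h
      have hle : ENNReal.ofReal (1 - w) ≤ reservoir α a w {p : I | (p : ℝ) ≤ τ} := by
        have hms : MeasurableSet {p : I | (p : ℝ) ≤ τ} :=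
          measurableSet_le measurable_subtype_coe measurable_const
        simp only [reservoir, Measure.add_apply, Measure.smul_apply, smul_eq_mul]
        rw [Measure.dirac_apply' _ hms, Set.indicator_of_mem (by simpa using h)]
        simp
      have : 1 - w ≤ reservoirCDF (reservoir α a w) τ :=
        (ENNReal.ofReal_le_iff_le_toReal (measure_ne_top _ _)).mp hle
      linarith
  rw [reservoirQuantile, hset, csInf_Ici]

/-- The window `[S/(S+k), (S+1/2)/(S+k)]` has length `1/(2(S+k))`, the reservoir has density at
least `w` there, and the likelihood is at least half of `uniformMix`. -/
lemma ofReal_mul_uniformMix_le (ha : (0 : ℝ) < a) (hw : 0 ≤ w) {S k : ℕ} (hm : 0 < S + k)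
    (hS : (S + 1 / 2) / (S + k : ℝ) ≤ a) {s : Set I}
    (hsub : ∀ x : I, (x : ℝ) ≤ (S + 1 / 2) / (S + k : ℝ) → x ∈ s) :
    ENNReal.ofReal (w / (4 * (S + k)) * uniformMix S k) ≤
      ∫⁻ x in s, armLik x S k ∂reservoir α a w := by
  have hm' : (0 : ℝ) < S + k := by exact_mod_cast hm
  have ha1 : (a : ℝ) ≤ 1 := a.2.2
  have hle : S / (S + k : ℝ) ≤ (S + 1 / 2) / (S + k : ℝ) := by gcongr; linarith
  set u : I := ⟨S / (S + k : ℝ), by positivity, by linarith⟩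
  set v : I := ⟨(S + 1 / 2) / (S + k : ℝ), by positivity, by linarith⟩
  have hJs : Set.Icc u v ⊆ s := fun x hx => hsub x hx.2
  have hJa : Set.Icc u v ⊆ Set.Iic a := fun x hx => by
    have h1 : (x : ℝ) ≤ v := hx.2
    exact Subtype.coe_le_coe.mp (h1.trans hS)
  have hg := uniformMix_pos S k
  calc ENNReal.ofReal (w / (4 * (S + k)) * uniformMix S k)
      ≤ ENNReal.ofReal (uniformMix S k / 2 * (w / a * (1 / 2 / (S + k)))) := by
        apply ENNReal.ofReal_le_ofReal
        have : w ≤ w / a := by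
          rw [le_div_iff₀ ha]; nlinarith
        calc w / (4 * (S + k)) * uniformMix S k = uniformMix S k / 2 * (w * (1 / 2 / (S + k))) := by
              field_simp; ring
          _ ≤ _ := by gcongr
    _ = ENNReal.ofReal (uniformMix S k / 2) * (ENNReal.ofReal (w / a) * volume (Set.Icc u v)) := by
        rw [unitInterval.volume_Icc, ENNReal.ofReal_mul (by positivity),
          ENNReal.ofReal_mul (by positivity)]
        congr 3
        simp only [u, v]
        ring
    _ ≤ ENNReal.ofReal (uniformMix S k / 2) * reservoir α a w (Set.Icc u v) := by
        gcongr
        exact ofReal_mul_volume_le_reservoir measurableSet_Icc hJa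
    _ = ∫⁻ x in Set.Icc u v, ENNReal.ofReal (uniformMix S k / 2) ∂reservoir α a w := by simp
    _ ≤ ∫⁻ x in Set.Icc u v, armLik x S k ∂reservoir α a w := by
        refine setLIntegral_mono (measurable_armLik S k) fun x hx => ?_
        rw [armLik_eq_ofReal]
        exact ENNReal.ofReal_le_ofReal (half_uniformMix_le_likelihood hm hx.1 hx.2 x.2.2)
    _ ≤ _ := lintegral_mono_set hJs

/-- Every data set of size `m` is compatible with a mean below `β`, at an exponential cost. -/
lemma ofReal_mul_pow_le (hw : 0 ≤ w) {β : ℝ} (hβ : 0 < β) (hβa : β < a) (S k : ℕ) :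
    ENNReal.ofReal (w * (β / 4)) * ENNReal.ofReal (β / 4) ^ (S + k) ≤
      ∫⁻ x in {x : I | (x : ℝ) < β}, armLik x S k ∂reservoir α a w := by
  have ha1 : (a : ℝ) ≤ 1 := a.2.2
  have ha : (0 : ℝ) < a := hβ.trans hβa
  -- On `[β/4, β/2]` both `x` and `1 - x` are at least `β/4`.
  set u : I := ⟨β / 4, by linarith, by linarith⟩
  set v : I := ⟨β / 2, by linarith, by linarith⟩
  have hJs : Set.Icc u v ⊆ {x : I | (x : ℝ) < β} := fun x hx => by
    have h1 : (x : ℝ) ≤ β / 2 := hx.2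
    simp only [Set.mem_ofPred_eq]; linarith
  have hJa : Set.Icc u v ⊆ Set.Iic a := fun x hx => by
    have h1 : (x : ℝ) ≤ β / 2 := hx.2
    have h2 : (x : ℝ) ≤ a := by linarith
    exact Subtype.coe_le_coe.mp h2
  calc ENNReal.ofReal (w * (β / 4)) * ENNReal.ofReal (β / 4) ^ (S + k)
      ≤ ENNReal.ofReal (β / 4) ^ (S + k) * (ENNReal.ofReal (w / a) * volume (Set.Icc u v)) := by
        rw [mul_comm, unitInterval.volume_Icc, ← ENNReal.ofReal_mul (by positivity)]
        gcongr
        · rw [le_div_iff₀ ha]; nlinarith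
        · simp only [u, v]; linarith
    _ ≤ ENNReal.ofReal (β / 4) ^ (S + k) * reservoir α a w (Set.Icc u v) := by
        gcongr
        exact ofReal_mul_volume_le_reservoir measurableSet_Icc hJa
    _ = ∫⁻ x in Set.Icc u v, ENNReal.ofReal (β / 4) ^ (S + k) ∂reservoir α a w := by simp
    _ ≤ ∫⁻ x in Set.Icc u v, armLik x S k ∂reservoir α a w := by
        refine setLIntegral_mono (measurable_armLik S k) fun x hx => ?_
        have h1 : β / 4 ≤ x := hx.1
        have h2 : (x : ℝ) ≤ β / 2 := hx.2
        rw [armLik, reward_apply_true, reward_apply_false, pow_add]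
        gcongr
        linarith
    _ ≤ _ := lintegral_mono_set hJs

end Reservoir

/-! ### The variance-stabilizing angle -/

/-- The angle `arccos (1 - 2 x)`, whose derivative is `1 / √(x (1 - x))`. -/
def angle (x : ℝ) : ℝ := Real.arccos (1 - 2 * x)

/-- The standard deviation of a Bernoulli variable. -/
def bernoulliSD (x : ℝ) : ℝ := Real.sqrt (x * (1 - x))

lemma bernoulliSD_pos {x : ℝ} (h0 : 0 < x) (h1 : x < 1) : 0 < bernoulliSD x :=
  Real.sqrt_pos.mpr (mul_pos h0 (by linarith))

lemma sq_bernoulliSD {x : ℝ} (h0 : 0 ≤ x) (h1 : x ≤ 1) : bernoulliSD x ^ 2 = x * (1 - x) :=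
  Real.sq_sqrt (mul_nonneg h0 (by linarith))

lemma angle_mono : Monotone angle := fun x y h => Real.arccos_le_arccos (by linarith)

lemma angle_lt_angle {x y : ℝ} (h0 : 0 ≤ x) (h : x < y) (h1 : y ≤ 1) : angle x < angle y :=
  Real.arccos_lt_arccos (by linarith) (by linarith) (by linarith)

lemma angle_zero : angle 0 = 0 := by simp [angle]

lemma continuous_angle : Continuous angle := by unfold angle; fun_prop

lemma angle_half_one_sub_cos {t : ℝ} (h0 : 0 ≤ t) (h1 : t ≤ Real.pi) :
    angle ((1 - Real.cos t) / 2) = t := by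
  rw [angle, show 1 - 2 * ((1 - Real.cos t) / 2) = Real.cos t by ring, Real.arccos_cos h0 h1]

lemma hasDerivAt_angle {x : ℝ} (h0 : 0 < x) (h1 : x < 1) :
    HasDerivAt angle (1 / bernoulliSD x) x := by
  have h := (Real.hasDerivAt_arccos (x := 1 - 2 * x) (by linarith) (by linarith)).comp x
    (((hasDerivAt_id x).const_mul 2).const_sub 1)
  refine h.congr_deriv ?_
  have h4 : Real.sqrt (1 - (1 - 2 * x) ^ 2) = 2 * bernoulliSD x := by
    rw [show 1 - (1 - 2 * x) ^ 2 = 2 ^ 2 * (x * (1 - x)) by ring,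
      Real.sqrt_mul (by norm_num), Real.sqrt_sq (by norm_num), bernoulliSD]
  have := bernoulliSD_pos h0 h1
  simp only [id] at *
  rw [h4]
  field_simp

/-- A Bernoulli standard deviation is at most `1/2`. -/
lemma two_mul_sub_le_angle_sub {x y : ℝ} (h0 : 0 < x) (hxy : x ≤ y) (h1 : y < 1) :
    2 * (y - x) ≤ angle y - angle x := by
  refine Convex.mul_sub_le_image_sub_of_le_deriv (convex_Icc x y)
    continuous_angle.continuousOn (fun z hz => ?_) (fun z hz => ?_) x ⟨le_rfl, hxy⟩ y ⟨hxy, le_rfl⟩ hxy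
  all_goals
    rw [interior_Icc] at hz
    have hz0 : 0 < z := h0.trans hz.1
    have hz1 : z < 1 := hz.2.trans h1
  · exact (hasDerivAt_angle hz0 hz1).differentiableAt.differentiableWithinAt
  · rw [(hasDerivAt_angle hz0 hz1).deriv, le_div_iff₀ (bernoulliSD_pos hz0 hz1)]
    have := sq_bernoulliSD hz0.le hz1.le
    have := bernoulliSD_pos hz0 hz1
    nlinarith [sq_nonneg (2 * z - 1)]

/-- The derivative `1 / bernoulliSD` is Lipschitz away from 0 and 1; the mean value inequality is
applied to `angle` minus its tangent. -/
lemma exists_angle_taylor {l u : ℝ} (hl : 0 < l) (hu : u < 1) :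
    ∃ C : ℝ, 0 ≤ C ∧ ∀ x ∈ Set.Icc l u, ∀ y ∈ Set.Icc l u,
      |angle y - angle x - (y - x) / bernoulliSD x| ≤ C * (y - x) ^ 2 := by
  have hin : ∀ x ∈ Set.Icc l u, 0 < x ∧ x < 1 := fun x hx => ⟨hl.trans_le hx.1, hx.2.trans_lt hu⟩
  set s' : ℝ → ℝ := fun x => -((1 - 2 * x) / (2 * bernoulliSD x)) / bernoulliSD x ^ 2
  have hs : ∀ x ∈ Set.Icc l u, HasDerivAt (fun z => (bernoulliSD z)⁻¹) (s' x) x := by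
    intro x hx
    obtain ⟨h0, h1⟩ := hin x hx
    have hb := bernoulliSD_pos h0 h1
    have hd : HasDerivAt (fun z : ℝ => z * (1 - z)) (1 - 2 * x) x := by
      refine ((hasDerivAt_id x).mul ((hasDerivAt_id x).const_sub 1)).congr_deriv ?_
      simp only [id]; ring
    exact (hd.sqrt (mul_pos h0 (by linarith)).ne').inv hb.ne'
  have hcont : ContinuousOn s' (Set.Icc l u) := by
    have hbc : Continuous bernoulliSD := by unfold bernoulliSD; fun_prop
    have hne : ∀ x ∈ Set.Icc l u, bernoulliSD x ≠ 0 := fun x hx =>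
      (bernoulliSD_pos (hin x hx).1 (hin x hx).2).ne'
    refine ContinuousOn.div (ContinuousOn.neg (ContinuousOn.div (by fun_prop) (by fun_prop) ?_))
      (by fun_prop) ?_
    · intro x hx; exact mul_ne_zero two_ne_zero (hne x hx)
    · intro x hx; exact pow_ne_zero _ (hne x hx)
  obtain ⟨C, hC⟩ := isCompact_Icc.exists_bound_of_continuousOn hcont
  refine ⟨|C|, abs_nonneg _, fun x hx y hy => ?_⟩
  have hlip : ∀ z ∈ Set.Icc l u, ∀ z' ∈ Set.Icc l u,
      ‖(bernoulliSD z')⁻¹ - (bernoulliSD z)⁻¹‖ ≤ |C| * ‖z' - z‖ := fun z hz z' hz' =>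
    Convex.norm_image_sub_le_of_norm_hasDerivWithin_le
      (fun w hw => (hs w hw).hasDerivWithinAt) (fun w hw => (hC w hw).trans (le_abs_self C))
      (convex_Icc l u) hz hz'
  have hsub : Set.uIcc x y ⊆ Set.Icc l u := Set.uIcc_subset_Icc hx hy
  have := Convex.norm_image_sub_le_of_norm_hasDerivWithin_le (s := Set.uIcc x y)
    (f := fun z => angle z - (bernoulliSD x)⁻¹ * z)
    (f' := fun z => (bernoulliSD z)⁻¹ - (bernoulliSD x)⁻¹) (C := |C| * |y - x|)
    (fun z hz => by
      have h := hin z (hsub hz)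
      refine ((hasDerivAt_angle h.1 h.2).sub ((hasDerivAt_id z).const_mul _)).hasDerivWithinAt.congr_deriv ?_
      rw [one_div, mul_one])
    (fun z hz => (hlip x hx z (hsub hz)).trans (by
      gcongr
      rw [Real.norm_eq_abs]
      exact Set.abs_sub_left_of_mem_uIcc hz))
    (convex_uIcc x y) Set.left_mem_uIcc Set.right_mem_uIcc
  rw [Real.norm_eq_abs, Real.norm_eq_abs] at this
  calc |angle y - angle x - (y - x) / bernoulliSD x|
      = |angle y - (bernoulliSD x)⁻¹ * y - (angle x - (bernoulliSD x)⁻¹ * x)| := by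
        congr 1; ring
    _ ≤ |C| * |y - x| * |y - x| := this
    _ = |C| * (y - x) ^ 2 := by rw [mul_assoc, ← sq, sq_abs]

/-! ### One step of the Gaussian profile -/

/-- The exponential is the ratio of `exp (-K ξ²/2)` at `ξ + D z` and at `ξ`. It is expanded to
second order in `D`, with a cubic error uniform on `0 ≤ ξ ≤ L`. -/
lemma exp_gaussian_increment_ge {K L B D ξ z : ℝ} (hK : 0 ≤ K) (hξ : 0 ≤ ξ) (hξL : ξ ≤ L)
    (hB : 0 ≤ B) (hD : 0 ≤ D) (hz : |z| ≤ B) (hDB : D * B ≤ 1) (hDK : K * (L + 1) * B * D ≤ 1) :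
    1 - K * ξ * (D * z) + (K ^ 2 * ξ ^ 2 - K) * (D * z) ^ 2 / 2 -
      ((K * (L + 1) * B) ^ 3 + K ^ 2 * L * B ^ 3) * D ^ 3 ≤
      Real.exp (-K * ξ * (D * z) - K * (D * z) ^ 2 / 2) := by
  have hL : 0 ≤ L := hξ.trans hξL
  set Δ := D * z with hΔ
  have hΔB : |Δ| ≤ D * B := by rw [hΔ, abs_mul, abs_of_nonneg hD]; gcongr
  have hΔsq : Δ ^ 2 ≤ D * B := by
    rw [← sq_abs]
    calc |Δ| ^ 2 = |Δ| * |Δ| := sq _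
      _ ≤ (D * B) * 1 := mul_le_mul hΔB (hΔB.trans hDB) (abs_nonneg _) (by positivity)
      _ = _ := mul_one _
  have ht : |-K * ξ * Δ - K * Δ ^ 2 / 2| ≤ K * (L + 1) * B * D := by
    calc |-K * ξ * Δ - K * Δ ^ 2 / 2| ≤ |-K * ξ * Δ| + |K * Δ ^ 2 / 2| := abs_sub _ _
      _ = K * ξ * |Δ| + K * Δ ^ 2 / 2 := by
        rw [abs_mul, abs_mul, abs_neg, abs_of_nonneg hK, abs_of_nonneg hξ,
          abs_of_nonneg (by positivity : 0 ≤ K * Δ ^ 2 / 2)]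
      _ ≤ K * L * (D * B) + K * (D * B) / 1 := by gcongr; norm_num
      _ = _ := by ring
  set t := -K * ξ * Δ - K * Δ ^ 2 / 2 with htdef
  have h3 := Real.exp_bound (ht.trans hDK) (n := 3) (by norm_num)
  have hsum : ∑ m ∈ Finset.range 3, t ^ m / (m.factorial : ℝ) = 1 + t + t ^ 2 / 2 := by
    simp [Finset.sum_range_succ, Nat.factorial]
  rw [hsum] at h3
  have h4 : |t| ^ 3 * (((3 : ℕ).succ : ℝ) / ((Nat.factorial 3 : ℕ) * (3 : ℕ))) ≤
      (K * (L + 1) * B * D) ^ 3 := by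
    have : (((3 : ℕ).succ : ℝ) / ((Nat.factorial 3 : ℕ) * (3 : ℕ))) ≤ 1 := by
      norm_num [Nat.factorial]
    calc _ ≤ |t| ^ 3 * 1 := by gcongr
      _ ≤ _ := by rw [mul_one]; gcongr
  have h5 : 1 + t + t ^ 2 / 2 - (K * (L + 1) * B * D) ^ 3 ≤ Real.exp t := by
    have := (abs_le.mp (h3.trans h4)).1
    linarith
  have hcube : -(D * B) ^ 3 ≤ Δ ^ 3 := by
    have : |Δ ^ 3| ≤ (D * B) ^ 3 := by rw [abs_pow]; gcongr
    exact (abs_le.mp this).1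
  have h6 : K ^ 2 * ξ ^ 2 * Δ ^ 2 - K ^ 2 * L * (D * B) ^ 3 ≤ t ^ 2 := by
    have e : t ^ 2 = K ^ 2 * ξ ^ 2 * Δ ^ 2 + K ^ 2 * ξ * Δ ^ 3 + K ^ 2 * Δ ^ 4 / 4 := by
      rw [htdef]; ring
    have h7 : K ^ 2 * ξ * -(D * B) ^ 3 ≤ K ^ 2 * ξ * Δ ^ 3 := by gcongr
    have h8 : K ^ 2 * ξ * (D * B) ^ 3 ≤ K ^ 2 * L * (D * B) ^ 3 := by gcongr
    have h9 : 0 ≤ K ^ 2 * Δ ^ 4 / 4 := by positivity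
    rw [e]; linarith
  have h10 : 0 ≤ K ^ 2 * L * (D * B) ^ 3 := by positivity
  have h11 : ((K * (L + 1) * B) ^ 3 + K ^ 2 * L * B ^ 3) * D ^ 3 =
    (K * (L + 1) * B * D) ^ 3 + K ^ 2 * L * (D * B) ^ 3 := by ring
  rw [h11]
  have h12 : t = -K * ξ * Δ - K * Δ ^ 2 / 2 := htdef
  linarith

/-- Here `y0`, `y1` are the values of a standardized reward, the summand `D` is the descent of the
boundary, and `r0`, `r1` are errors. For `U = exp (-K ξ²/2)` one has `U'' + 2U' + (1+lam)U =
((Kξ-1)² + lam - K) U`. With `K = lam/2` the surplus is `lam/2`: half of it absorbs the errors and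
`lam/4` remains. -/
lemma exists_gaussian_step {lam L Y : ℝ} (hlam : 0 < lam) (hL : 0 ≤ L) (hY : 0 ≤ Y) :
    ∃ ν : ℝ, 0 < ν ∧ ∀ D, 0 < D → D ≤ ν → ∀ p y0 y1 r0 r1 ξ : ℝ, 0 ≤ p → p ≤ 1 →
      p * y1 + (1 - p) * y0 = 0 → p * y1 ^ 2 + (1 - p) * y0 ^ 2 = 1 → |y0| ≤ Y → |y1| ≤ Y →
      |r0| ≤ ν * D → |r1| ≤ ν * D → 0 ≤ ξ → ξ ≤ L →
      1 - (1 + lam) * D ^ 2 / 2 + D ^ 2 / 2 * ((lam / 2 * ξ - 1) ^ 2 + lam / 4) ≤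
        p * Real.exp (-(lam / 2) * ξ * (D * (y1 + D + r1)) -
          lam / 2 * (D * (y1 + D + r1)) ^ 2 / 2) +
        (1 - p) * Real.exp (-(lam / 2) * ξ * (D * (y0 + D + r0)) -
          lam / 2 * (D * (y0 + D + r0)) ^ 2 / 2) := by
  set K := lam / 2 with hK
  have hKpos : 0 < K := by positivity
  set B := Y + 2 with hB
  have hBpos : 0 < B := by positivity
  set C2 := (K * (L + 1) * B) ^ 3 + K ^ 2 * L * B ^ 3 with hC2
  have hC2pos : 0 ≤ C2 := by positivity
  set C3 := K * L + (K ^ 2 * L ^ 2 + K) * (2 * Y + 2) + C2 with hC3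
  have hC3pos : 0 ≤ C3 := by positivity
  refine ⟨min 1 (min (1 / (B + K * (L + 1) * B)) (lam / 8 / (C3 + 1))), by positivity, ?_⟩
  set ν := min 1 (min (1 / (B + K * (L + 1) * B)) (lam / 8 / (C3 + 1))) with hν
  have hνpos : 0 < ν := by positivity
  have hν1 : ν ≤ 1 := min_le_left _ _
  have hν2 : ν * (B + K * (L + 1) * B) ≤ 1 := by
    rw [← le_div_iff₀ (by positivity)]
    exact (min_le_right _ _).trans (min_le_left _ _)
  have hν3 : ν * (C3 + 1) ≤ lam / 8 := by
    rw [← le_div_iff₀ (by positivity)]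
    exact (min_le_right _ _).trans (min_le_right _ _)
  intro D hD hDν p y0 y1 r0 r1 ξ hp hp1 hmean hvar hy0 hy1 hr0 hr1 hξ hξL
  have hD1 : D ≤ 1 := hDν.trans hν1
  have hDB' : D * (B + K * (L + 1) * B) ≤ 1 := le_trans (by gcongr) hν2
  have hDB : D * B ≤ 1 := by
    have : 0 ≤ D * (K * (L + 1) * B) := by positivity
    linarith
  have hDK : K * (L + 1) * B * D ≤ 1 := by
    have : 0 ≤ D * B := by positivity
    linarith
  have hrD : ∀ r, |r| ≤ ν * D → |D + r| ≤ 2 * D := by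
    intro r hr
    calc |D + r| ≤ |D| + |r| := abs_add_le _ _
      _ ≤ D + 1 * D := by rw [abs_of_pos hD]; gcongr; exact hr.trans (by gcongr)
      _ = 2 * D := by ring
  have hz : ∀ y r, |y| ≤ Y → |r| ≤ ν * D → |y + D + r| ≤ B := by
    intro y r hy hr
    calc |y + D + r| = |y + (D + r)| := by rw [add_assoc]
      _ ≤ |y| + |D + r| := abs_add_le _ _
      _ ≤ Y + 2 * 1 := by gcongr; exact (hrD r hr).trans (by gcongr)
      _ = B := by rw [hB]; ring
  have e1 := exp_gaussian_increment_ge hKpos.le hξ hξL hBpos.le hD.le (hz y1 r1 hy1 hr1) hDB hDK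
  have e0 := exp_gaussian_increment_ge hKpos.le hξ hξL hBpos.le hD.le (hz y0 r0 hy0 hr0) hDB hDK
  rw [← hC2] at e1 e0
  set E1 := Real.exp (-K * ξ * (D * (y1 + D + r1)) - K * (D * (y1 + D + r1)) ^ 2 / 2)
  set E0 := Real.exp (-K * ξ * (D * (y0 + D + r0)) - K * (D * (y0 + D + r0)) ^ 2 / 2)
  have hq : 0 ≤ 1 - p := by linarith
  have hsum := add_le_add (mul_le_mul_of_nonneg_left e1 hp) (mul_le_mul_of_nonneg_left e0 hq)
  refine le_trans ?_ hsum
  set er := p * r1 + (1 - p) * r0 with her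
  have hcomb : ∀ a b c : ℝ, |a| ≤ c → |b| ≤ c → |p * a + (1 - p) * b| ≤ c := by
    intro a b c ha hb
    calc |p * a + (1 - p) * b| ≤ |p * a| + |(1 - p) * b| := abs_add_le _ _
      _ = p * |a| + (1 - p) * |b| := by rw [abs_mul, abs_mul, abs_of_nonneg hp, abs_of_nonneg hq]
      _ ≤ p * c + (1 - p) * c := by gcongr
      _ = c := by ring
  have her1 : |er| ≤ ν * D := hcomb _ _ _ hr1 hr0
  set q1 := 2 * y1 * (D + r1) + (D + r1) ^ 2 with hq1
  set q0 := 2 * y0 * (D + r0) + (D + r0) ^ 2 with hq0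
  have hqb : ∀ y r, |y| ≤ Y → |r| ≤ ν * D →
      |2 * y * (D + r) + (D + r) ^ 2| ≤ (4 * Y + 4) * D := by
    intro y r hy hr
    have h1 := hrD r hr
    calc |2 * y * (D + r) + (D + r) ^ 2| ≤ |2 * y * (D + r)| + |(D + r) ^ 2| := abs_add_le _ _
      _ = 2 * |y| * |D + r| + |D + r| * |D + r| := by
        rw [abs_mul, abs_mul, abs_pow, sq, abs_of_pos (by norm_num : (0 : ℝ) < 2)]
      _ ≤ 2 * Y * (2 * D) + (2 * 1) * (2 * D) := by
        gcongr; exact h1.trans (by gcongr)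
      _ = _ := by ring
  set eq := p * q1 + (1 - p) * q0 with heq
  have heqb : |eq| ≤ (4 * Y + 4) * D := hcomb _ _ _ (hqb _ _ hy1 hr1) (hqb _ _ hy0 hr0)
  have hident : p * (1 - K * ξ * (D * (y1 + D + r1)) +
        (K ^ 2 * ξ ^ 2 - K) * (D * (y1 + D + r1)) ^ 2 / 2 - C2 * D ^ 3) +
      (1 - p) * (1 - K * ξ * (D * (y0 + D + r0)) +
        (K ^ 2 * ξ ^ 2 - K) * (D * (y0 + D + r0)) ^ 2 / 2 - C2 * D ^ 3) =
      1 - K * ξ * D * (D + er) + (K ^ 2 * ξ ^ 2 - K) * D ^ 2 / 2 * (1 + eq) - C2 * D ^ 3 := by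
    have a1 : 1 + eq = p * (y1 + D + r1) ^ 2 + (1 - p) * (y0 + D + r0) ^ 2 := by
      rw [heq, hq1, hq0]; linear_combination -hvar
    have a2 : D + er = p * (y1 + D + r1) + (1 - p) * (y0 + D + r0) := by
      rw [her]; linear_combination -hmean
    rw [a1, a2]; ring
  rw [hident]
  have b1 : K * ξ * D * er ≤ K * L * ν * D ^ 2 := by
    calc K * ξ * D * er ≤ K * ξ * D * (ν * D) := by
          gcongr; exact (le_abs_self _).trans her1
      _ ≤ K * L * D * (ν * D) := by gcongr
      _ = _ := by ring
  have b2 : -((K ^ 2 * L ^ 2 + K) * (2 * Y + 2) * D * D ^ 2) ≤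
      (K ^ 2 * ξ ^ 2 - K) * D ^ 2 / 2 * eq := by
    have : |(K ^ 2 * ξ ^ 2 - K) * D ^ 2 / 2 * eq| ≤
        (K ^ 2 * L ^ 2 + K) * (2 * Y + 2) * D * D ^ 2 := by
      rw [abs_mul, abs_div, abs_mul, abs_of_nonneg (sq_nonneg D), abs_two]
      have : |K ^ 2 * ξ ^ 2 - K| ≤ K ^ 2 * L ^ 2 + K := by
        calc |K ^ 2 * ξ ^ 2 - K| ≤ |K ^ 2 * ξ ^ 2| + |K| := abs_sub _ _
          _ = K ^ 2 * ξ ^ 2 + K := by rw [abs_of_nonneg (by positivity), abs_of_pos hKpos]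
          _ ≤ _ := by gcongr
      calc _ ≤ (K ^ 2 * L ^ 2 + K) * D ^ 2 / 2 * ((4 * Y + 4) * D) := by gcongr
        _ = _ := by ring
    exact (abs_le.mp this).1
  have b3 : K * L * ν * D ^ 2 + (K ^ 2 * L ^ 2 + K) * (2 * Y + 2) * D * D ^ 2 + C2 * D ^ 3 ≤
      lam / 8 * D ^ 2 := by
    calc _ = (K * L * ν + ((K ^ 2 * L ^ 2 + K) * (2 * Y + 2) + C2) * D) * D ^ 2 := by ring
      _ ≤ (K * L * ν + ((K ^ 2 * L ^ 2 + K) * (2 * Y + 2) + C2) * ν) * D ^ 2 := by gcongr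
      _ = ν * C3 * D ^ 2 := by rw [hC3]; ring
      _ ≤ lam / 8 * D ^ 2 := by gcongr; linarith
  have hlamK : lam = 2 * K := by rw [hK]; ring
  rw [hlamK] at b3 ⊢
  linarith [b1, b2, b3]

/-- The profile `exp (- K ξ₊² / 2) - τ`, cut off at zero. -/
def profile (K τ ξ : ℝ) : ℝ := max 0 (Real.exp (-(K * max ξ 0 ^ 2 / 2)) - τ)

lemma profile_nonneg (K τ ξ : ℝ) : 0 ≤ profile K τ ξ := le_max_left _ _

lemma profile_antitone {K : ℝ} (hK : 0 ≤ K) (τ : ℝ) : Antitone (profile K τ) := by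
  intro x y h
  unfold profile
  have : max x 0 ≤ max y 0 := max_le_max_right 0 h
  have h0 : 0 ≤ max x 0 := le_max_right _ _
  gcongr

lemma gaussian_sub_le_profile {K : ℝ} (hK : 0 ≤ K) (τ ξ : ℝ) :
    Real.exp (-(K * ξ ^ 2 / 2)) - τ ≤ profile K τ ξ := by
  refine le_trans ?_ (le_max_right _ _)
  have : max ξ 0 ^ 2 ≤ ξ ^ 2 := by
    rcases le_total ξ 0 with h | h
    · rw [max_eq_right h]; simpa using sq_nonneg ξ
    · rw [max_eq_left h]
  gcongr

lemma profile_le_one {K τ : ℝ} (hK : 0 ≤ K) (hτ : 0 ≤ τ) (ξ : ℝ) : profile K τ ξ ≤ 1 := by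
  refine max_le zero_le_one ?_
  have : Real.exp (-(K * max ξ 0 ^ 2 / 2)) ≤ 1 := by
    rw [Real.exp_le_one_iff]
    have : 0 ≤ K * max ξ 0 ^ 2 / 2 := by positivity
    linarith
  linarith

lemma profile_of_nonpos {K τ ξ : ℝ} (hτ : τ ≤ 1) (hξ : ξ ≤ 0) : profile K τ ξ = 1 - τ := by
  simp [profile, max_eq_right hξ, hτ]

lemma profile_of_mem {K L ξ : ℝ} (hK : 0 ≤ K) (hξ : 0 ≤ ξ) (hξL : ξ ≤ L) :
    profile K (Real.exp (-(K * L ^ 2 / 2))) ξ =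
      Real.exp (-(K * ξ ^ 2 / 2)) - Real.exp (-(K * L ^ 2 / 2)) := by
  rw [profile, max_eq_left hξ, max_eq_right]
  rw [sub_nonneg]
  gcongr

lemma profile_of_ge {K L ξ : ℝ} (hK : 0 ≤ K) (hL : 0 ≤ L) (hξL : L ≤ ξ) :
    profile K (Real.exp (-(K * L ^ 2 / 2))) ξ = 0 := by
  rw [profile, max_eq_left (hL.trans hξL), max_eq_left]
  rw [sub_nonpos]
  gcongr

/-- Subtracting the level `τ` from the Gaussian costs `(1 + lam) τ` in the recursion, and the
surplus must cover it. If `lam/2 * ξ ≥ 3` the square suffices; otherwise the Gaussian is at least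
`exp (-9/lam)`, far above `τ`. -/
lemma add_one_mul_cutoff_le {lam τ ξ : ℝ} (hlam : 0 < lam) (hlam1 : lam < 1) (hτ0 : 0 ≤ τ)
    (hτ : 8 * τ ≤ lam * Real.exp (-(9 / lam))) (hξ : 0 ≤ ξ)
    (hGτ : τ ≤ Real.exp (-(lam / 2 * ξ ^ 2 / 2))) :
    (1 + lam) * τ ≤ Real.exp (-(lam / 2 * ξ ^ 2 / 2)) * ((lam / 2 * ξ - 1) ^ 2 + lam / 4) := by
  have hGpos := Real.exp_pos (-(lam / 2 * ξ ^ 2 / 2))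
  have h9 : 0 ≤ lam / 2 * ξ := by positivity
  rcases le_total 3 (lam / 2 * ξ) with h3 | h3
  · have h2 : 2 ≤ (lam / 2 * ξ - 1) ^ 2 + lam / 4 := by
      have : 2 ^ 2 ≤ (lam / 2 * ξ - 1) ^ 2 := pow_le_pow_left₀ (by norm_num) (by linarith) 2
      linarith
    calc (1 + lam) * τ ≤ (1 + lam) * Real.exp (-(lam / 2 * ξ ^ 2 / 2)) := by gcongr
      _ ≤ ((lam / 2 * ξ - 1) ^ 2 + lam / 4) * Real.exp (-(lam / 2 * ξ ^ 2 / 2)) := by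
        exact mul_le_mul_of_nonneg_right (by linarith) hGpos.le
      _ = _ := mul_comm _ _
  · have hG9 : Real.exp (-(9 / lam)) ≤ Real.exp (-(lam / 2 * ξ ^ 2 / 2)) := by
      have : lam / 2 * ξ ^ 2 / 2 ≤ 9 / lam := by
        have e : lam / 2 * ξ ^ 2 / 2 = (lam / 2 * ξ) ^ 2 / lam := by field_simp
        have e2 : (lam / 2 * ξ) ^ 2 ≤ 3 ^ 2 := pow_le_pow_left₀ h9 h3 2
        rw [e]
        gcongr
        linarith
      gcongr
    generalize Real.exp (-(lam / 2 * ξ ^ 2 / 2)) = G at *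
    generalize Real.exp (-(9 / lam)) = E at *
    calc (1 + lam) * τ ≤ (lam / 4) * E := by
          have : lam * τ ≤ 1 * τ := by gcongr
          linarith
      _ ≤ (lam / 4) * G := by gcongr
      _ ≤ ((lam / 2 * ξ - 1) ^ 2 + lam / 4) * G := by
        gcongr
        linarith [sq_nonneg (lam / 2 * ξ - 1)]
      _ = _ := mul_comm _ _

lemma exists_profile_step {lam L Y : ℝ} (hlam : 0 < lam) (hlam1 : lam < 1) (hL : 0 ≤ L)
    (hY : 0 ≤ Y)
    (hτ : 8 * Real.exp (-(lam / 2 * L ^ 2 / 2)) ≤ lam * Real.exp (-(9 / lam))) :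
    ∃ ν : ℝ, 0 < ν ∧ ∀ D, 0 < D → D ≤ ν → ∀ p y0 y1 r0 r1 ξ : ℝ, 0 ≤ p → p ≤ 1 →
      p * y1 + (1 - p) * y0 = 0 → p * y1 ^ 2 + (1 - p) * y0 ^ 2 = 1 → |y0| ≤ Y → |y1| ≤ Y →
      |r0| ≤ ν * D → |r1| ≤ ν * D → 0 ≤ ξ → ξ ≤ L →
      (1 - (1 + lam) * D ^ 2 / 2) * profile (lam / 2) (Real.exp (-(lam / 2 * L ^ 2 / 2))) ξ ≤
        p * profile (lam / 2) (Real.exp (-(lam / 2 * L ^ 2 / 2))) (ξ + D * (y1 + D + r1)) +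
        (1 - p) * profile (lam / 2) (Real.exp (-(lam / 2 * L ^ 2 / 2)))
          (ξ + D * (y0 + D + r0)) := by
  obtain ⟨ν, hν, H⟩ := exists_gaussian_step hlam hL hY
  refine ⟨ν, hν, fun D hD hDν p y0 y1 r0 r1 ξ hp hp1 hm hv hy0 hy1 hr0 hr1 hξ hξL => ?_⟩
  have h := H D hD hDν p y0 y1 r0 r1 ξ hp hp1 hm hv hy0 hy1 hr0 hr1 hξ hξL
  set K := lam / 2 with hK
  have hKpos : 0 < K := by positivity
  set τ := Real.exp (-(K * L ^ 2 / 2)) with hτdef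
  have hτpos : 0 < τ := Real.exp_pos _
  rw [profile_of_mem hKpos.le hξ hξL, ← hτdef]
  set G := Real.exp (-(K * ξ ^ 2 / 2)) with hG
  have hGpos : 0 < G := Real.exp_pos _
  have hGτ : τ ≤ G := by rw [hτdef, hG]; gcongr
  have hprod : ∀ Δ : ℝ, Real.exp (-(K * (ξ + Δ) ^ 2 / 2)) =
      G * Real.exp (-K * ξ * Δ - K * Δ ^ 2 / 2) := by
    intro Δ
    rw [hG, ← Real.exp_add]
    congr 1; ring
  have hq : 0 ≤ 1 - p := by linarith
  have g1 := mul_le_mul_of_nonneg_left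
    (gaussian_sub_le_profile hKpos.le τ (ξ + D * (y1 + D + r1))) hp
  have g0 := mul_le_mul_of_nonneg_left
    (gaussian_sub_le_profile hKpos.le τ (ξ + D * (y0 + D + r0))) hq
  refine le_trans ?_ (add_le_add g1 g0)
  rw [hprod, hprod]
  have key : (1 + lam) * τ ≤ G * ((K * ξ - 1) ^ 2 + lam / 4) :=
    add_one_mul_cutoff_le hlam hlam1 hτpos.le hτ hξ hGτ
  have h2 := mul_le_mul_of_nonneg_left h hGpos.le
  have h3 := mul_le_mul_of_nonneg_left key (by positivity : 0 ≤ D ^ 2 / 2)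
  generalize Real.exp (-K * ξ * (D * (y1 + D + r1)) - K * (D * (y1 + D + r1)) ^ 2 / 2) = X1 at h2 ⊢
  generalize Real.exp (-K * ξ * (D * (y0 + D + r0)) - K * (D * (y0 + D + r0)) ^ 2 / 2) = X0 at h2 ⊢
  clear_value G τ K
  linarith only [h2, h3]

/-! ### One step of the Pólya urn -/

lemma exists_urn_step_core {lam L l u : ℝ} (hlam : 0 < lam) (hlam1 : lam < 1) (hL : 0 ≤ L)
    (hl : 0 < l) (hlu : l ≤ u) (hu : u < 1)
    (hτ : 8 * Real.exp (-(lam / 2 * L ^ 2 / 2)) ≤ lam * Real.exp (-(9 / lam))) :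
    ∃ ν : ℝ, 0 < ν ∧ ∀ D, 0 < D → D ≤ ν → ∀ n : ℝ, 0 < n → 1 ≤ ν * D ^ 2 * n →
      ∀ p ϑ ϑ' : ℝ, l ≤ p → p ≤ u → D ≤ (n + 1) * (ϑ - ϑ') →
      (n + 1) * (ϑ - ϑ') ≤ D * (1 + 1 / n) →
      0 ≤ D * n * (angle p - ϑ) → D * n * (angle p - ϑ) ≤ L →
      (1 - (1 + lam) * D ^ 2 / 2) * profile (lam / 2) (Real.exp (-(lam / 2 * L ^ 2 / 2)))
          (D * n * (angle p - ϑ)) ≤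
        p * profile (lam / 2) (Real.exp (-(lam / 2 * L ^ 2 / 2)))
          (D * (n + 1) * (angle ((n * p + 1) / (n + 1)) - ϑ')) +
        (1 - p) * profile (lam / 2) (Real.exp (-(lam / 2 * L ^ 2 / 2)))
          (D * (n + 1) * (angle (n * p / (n + 1)) - ϑ')) := by
  set Y := 1 / Real.sqrt (l * (1 - u)) with hY
  have hlu' : 0 < l * (1 - u) := mul_pos hl (by linarith)
  have hs0 : 0 < Real.sqrt (l * (1 - u)) := Real.sqrt_pos.mpr hlu'
  have hYpos : 0 < Y := by positivity
  obtain ⟨ν₀, hν₀, H⟩ := exists_profile_step hlam hlam1 hL hYpos.le hτ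
  obtain ⟨C, hC, HC⟩ := exists_angle_taylor (l := l / 2) (u := (1 + u) / 2) (by linarith)
    (by linarith)
  have h1u : 0 < 1 - u := by linarith
  set ν := min (min 1 ν₀) (min (min (l / 2) ((1 - u) / 2)) (ν₀ / (C + L + 1))) with hν
  have hνpos : 0 < ν := by positivity
  have hν1 : ν ≤ 1 := (min_le_left _ _).trans (min_le_left _ _)
  have hν2 : ν ≤ ν₀ := (min_le_left _ _).trans (min_le_right _ _)
  have hν3 : ν ≤ l / 2 := (min_le_right _ _).trans ((min_le_left _ _).trans (min_le_left _ _))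
  have hν4 : ν ≤ (1 - u) / 2 :=
    (min_le_right _ _).trans ((min_le_left _ _).trans (min_le_right _ _))
  have hν5 : ν * (C + L + 1) ≤ ν₀ := by
    rw [← le_div_iff₀ (by positivity)]
    exact (min_le_right _ _).trans (min_le_right _ _)
  clear_value ν
  refine ⟨ν, hνpos, fun D hD hDν n hn hνn p ϑ ϑ' hlp hpu hd1 hd2 hξ hξL => ?_⟩
  have hD1 : D ≤ 1 := hDν.trans hν1
  have hp0 : 0 < p := hl.trans_le hlp
  have hp1 : p < 1 := hpu.trans_lt hu
  have hσ := bernoulliSD_pos hp0 hp1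
  have hσ2 := sq_bernoulliSD hp0.le hp1.le
  have hinv : 1 / n ≤ ν * D ^ 2 := by rw [div_le_iff₀ hn]; exact hνn
  have hinv1 : 1 / (n + 1) ≤ ν * D ^ 2 := le_trans (by gcongr; linarith) hinv
  have hsq1 : D ^ 2 ≤ 1 := pow_le_one₀ hD.le hD1
  have hsmall : 1 / (n + 1) ≤ ν := hinv1.trans (by nlinarith)
  have hYσ : 1 / bernoulliSD p ≤ Y := by
    rw [hY]
    gcongr
    exact Real.sqrt_le_sqrt (mul_le_mul hlp (by linarith) h1u.le hp0.le)
  have hyb : ∀ b : ℝ, 0 ≤ b → b ≤ 1 → |(b - p) / bernoulliSD p| ≤ Y := by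
    intro b hb0 hb1
    rw [abs_div, abs_of_pos hσ]
    refine le_trans ?_ hYσ
    gcongr
    rw [abs_le]; constructor <;> linarith
  -- After a reward `b` the scaled distance grows by `D ((b - p)/bernoulliSD p + D + r)`. The
  -- remainder `r` collects the Taylor error, the term `angle p - ϑ` from replacing `n` by `n + 1`,
  -- and the excess of the boundary step; all are `O(ν D)` because `1/n ≤ ν D²`.
  have hr : ∀ b : ℝ, 0 ≤ b → b ≤ 1 →
      |(n + 1) * (angle ((n * p + b) / (n + 1)) - angle p) - (b - p) / bernoulliSD p +
        (angle p - ϑ) + ((n + 1) * (ϑ - ϑ') - D)| ≤ ν₀ * D := by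
    intro b hb0 hb1
    have hpb : (n * p + b) / (n + 1) - p = (b - p) / (n + 1) := by field_simp; ring
    have habs : |(b - p) / (n + 1)| ≤ ν := by
      rw [abs_div, abs_of_pos (by linarith : 0 < n + 1)]
      refine le_trans ?_ hsmall
      gcongr
      rw [abs_le]; constructor <;> linarith
    rw [← hpb, abs_le] at habs
    have hT := HC p ⟨by linarith, by linarith⟩ ((n * p + b) / (n + 1))
      ⟨by linarith [habs.1], by linarith [habs.2]⟩
    rw [hpb] at hT
    have hbp : (b - p) ^ 2 ≤ 1 := by
      rw [← sq_abs]
      refine pow_le_one₀ (abs_nonneg _) ?_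
      rw [abs_le]; constructor <;> linarith
    have h1 : |(n + 1) * (angle ((n * p + b) / (n + 1)) - angle p) - (b - p) / bernoulliSD p| ≤
        C * (1 / (n + 1)) := by
      have e : (n + 1) * (angle ((n * p + b) / (n + 1)) - angle p) - (b - p) / bernoulliSD p =
          (n + 1) * (angle ((n * p + b) / (n + 1)) - angle p -
            (b - p) / (n + 1) / bernoulliSD p) := by field_simp
      rw [e, abs_mul, abs_of_pos (by linarith : 0 < n + 1)]
      calc _ ≤ (n + 1) * (C * ((b - p) / (n + 1)) ^ 2) := by gcongr
        _ = C * (1 / (n + 1)) * (b - p) ^ 2 := by field_simp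
        _ ≤ C * (1 / (n + 1)) * 1 := by gcongr
        _ = _ := mul_one _
    have h2 : |angle p - ϑ| ≤ L * ν * D := by
      have hDn : 0 < D * n := by positivity
      have h0 : 0 ≤ angle p - ϑ := nonneg_of_mul_nonneg_right hξ hDn
      rw [abs_of_nonneg h0]
      calc angle p - ϑ = D * n * (angle p - ϑ) * (1 / n) / D := by field_simp
        _ ≤ L * (ν * D ^ 2) / D := by gcongr
        _ = L * ν * D := by field_simp
    have h3 : |(n + 1) * (ϑ - ϑ') - D| ≤ D * (1 / n) := by
      rw [abs_of_nonneg (by linarith)]; linarith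
    calc _ ≤ |(n + 1) * (angle ((n * p + b) / (n + 1)) - angle p) - (b - p) / bernoulliSD p| +
          |angle p - ϑ| + |(n + 1) * (ϑ - ϑ') - D| := abs_add_three _ _ _
      _ ≤ C * (ν * D ^ 2) + L * ν * D + D * (ν * D ^ 2) := by
        refine add_le_add (add_le_add (h1.trans (by gcongr)) h2) (h3.trans (by gcongr))
      _ = ν * (C * D + L + D ^ 2) * D := by ring
      _ ≤ ν * (C * 1 + L + 1) * D := by gcongr
      _ = ν * (C + L + 1) * D := by ring
      _ ≤ ν₀ * D := by gcongr
  have h := H D hD (hDν.trans hν2) p ((0 - p) / bernoulliSD p) ((1 - p) / bernoulliSD p)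
    _ _ (D * n * (angle p - ϑ)) hp0.le hp1.le (by field_simp; ring)
    (by rw [div_pow, div_pow, hσ2]; have : 1 - p ≠ 0 := by linarith
        field_simp; ring)
    (hyb 0 le_rfl zero_le_one) (hyb 1 zero_le_one le_rfl) (hr 0 le_rfl zero_le_one)
    (hr 1 zero_le_one le_rfl) hξ hξL
  refine h.trans (le_of_eq ?_)
  congr 3
  · ring
  · rw [add_zero]; ring

/-- Removes the restriction of the core step to a strip. Beyond `L` the left side vanishes. Below
the boundary, `p` is raised to the point `q` with `angle q = ϑ`: the profile is flat there, so the
left side is unchanged, while the right side can only decrease, since a larger urn proportion raises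
both the states reached and the chance of a success. -/
lemma exists_urn_step {lam L l m u : ℝ} (hlam : 0 < lam) (hlam1 : lam < 1) (hL : 0 ≤ L)
    (hl : 0 < l) (hlm : l ≤ m) (hmu : m < u) (hu : u < 1)
    (hτ : 8 * Real.exp (-(lam / 2 * L ^ 2 / 2)) ≤ lam * Real.exp (-(9 / lam))) :
    ∃ ν : ℝ, 0 < ν ∧ ∀ D, 0 < D → D ≤ ν → ∀ n : ℝ, 0 < n → 1 ≤ ν * D ^ 2 * n →
      ∀ p ϑ ϑ' : ℝ, 0 ≤ p → p ≤ 1 → angle l ≤ ϑ → ϑ ≤ angle m → D ≤ (n + 1) * (ϑ - ϑ') →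
      (n + 1) * (ϑ - ϑ') ≤ D * (1 + 1 / n) →
      (1 - (1 + lam) * D ^ 2 / 2) * profile (lam / 2) (Real.exp (-(lam / 2 * L ^ 2 / 2)))
          (D * n * (angle p - ϑ)) ≤
        p * profile (lam / 2) (Real.exp (-(lam / 2 * L ^ 2 / 2)))
          (D * (n + 1) * (angle ((n * p + 1) / (n + 1)) - ϑ')) +
        (1 - p) * profile (lam / 2) (Real.exp (-(lam / 2 * L ^ 2 / 2)))
          (D * (n + 1) * (angle (n * p / (n + 1)) - ϑ')) := by
  obtain ⟨ν₀, hν₀, H⟩ := exists_urn_step_core hlam hlam1 hL hl (hlm.trans hmu.le) hu hτ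
  have hgap : 0 < angle u - angle m :=
    sub_pos.mpr (angle_lt_angle (hl.le.trans hlm) hmu hu.le)
  set ν := min (min 1 ν₀) ((angle u - angle m) / (L + 1)) with hν
  have hνpos : 0 < ν := by positivity
  have hν1 : ν ≤ 1 := (min_le_left _ _).trans (min_le_left _ _)
  have hν2 : ν ≤ ν₀ := (min_le_left _ _).trans (min_le_right _ _)
  have hν3 : ν * (L + 1) ≤ angle u - angle m := by
    rw [← le_div_iff₀ (by positivity)]; exact min_le_right _ _
  clear_value ν
  refine ⟨ν, hνpos, fun D hD hDν n hn hνn p ϑ ϑ' hp0 hp1 hlϑ hϑm hd1 hd2 => ?_⟩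
  have hK : 0 ≤ lam / 2 := by positivity
  have hνn' : 1 ≤ ν₀ * D ^ 2 * n := hνn.trans (by gcongr)
  have hDn : 0 < D * n := by positivity
  have hD1 : D ≤ 1 := hDν.trans hν1
  have hinv : 1 / n ≤ ν * D ^ 2 := by rw [div_le_iff₀ hn]; exact hνn
  set U := profile (lam / 2) (Real.exp (-(lam / 2 * L ^ 2 / 2))) with hU
  have hanti : Antitone U := profile_antitone hK _
  rcases le_or_gt L (D * n * (angle p - ϑ)) with hbig | hsmall
  · rw [show U (D * n * (angle p - ϑ)) = 0 from profile_of_ge hK hL hbig, mul_zero]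
    exact add_nonneg (mul_nonneg hp0 (profile_nonneg _ _ _))
      (mul_nonneg (by linarith) (profile_nonneg _ _ _))
  have core : ∀ q, 0 ≤ q → q ≤ 1 → 0 ≤ D * n * (angle q - ϑ) → D * n * (angle q - ϑ) ≤ L →
      (1 - (1 + lam) * D ^ 2 / 2) * U (D * n * (angle q - ϑ)) ≤
        q * U (D * (n + 1) * (angle ((n * q + 1) / (n + 1)) - ϑ')) +
        (1 - q) * U (D * (n + 1) * (angle (n * q / (n + 1)) - ϑ')) := by
    intro q hq0 hq1 hξ hξL
    have h0 : 0 ≤ angle q - ϑ := nonneg_of_mul_nonneg_right hξ hDn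
    have h2 : angle q - ϑ ≤ ν * (L + 1) := by
      calc angle q - ϑ = D * n * (angle q - ϑ) * (1 / n) / D := by field_simp
        _ ≤ L * (ν * D ^ 2) / D := by gcongr
        _ = ν * (L * D) := by field_simp
        _ ≤ ν * (L * 1 + 1) := by gcongr; nlinarith
        _ = _ := by ring
    refine H D hD (hDν.trans hν2) n hn hνn' q ϑ ϑ' ?_ ?_ hd1 hd2 hξ hξL
    · by_contra hlt
      push Not at hlt
      have := angle_lt_angle hq0 hlt (hlm.trans (hmu.le.trans hu.le))
      linarith
    · by_contra hlt
      push Not at hlt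
      have := angle_lt_angle (hl.le.trans (hlm.trans hmu.le)) hlt hq1
      linarith
  rcases le_or_gt 0 (D * n * (angle p - ϑ)) with hpos | hneg
  · exact core p hp0 hp1 hpos hsmall.le
  have hϑ0 : 0 ≤ ϑ := (Real.arccos_nonneg _).trans hlϑ
  have hϑπ : ϑ ≤ Real.pi := hϑm.trans (Real.arccos_le_pi _)
  set q := (1 - Real.cos ϑ) / 2 with hq
  have hqϑ : angle q = ϑ := angle_half_one_sub_cos hϑ0 hϑπ
  have hq0 : 0 ≤ q := by have := Real.cos_le_one ϑ; rw [hq]; linarith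
  have hq1 : q ≤ 1 := by have := Real.neg_one_le_cos ϑ; rw [hq]; linarith
  have hpq : p ≤ q := by
    by_contra hlt
    push Not at hlt
    have h1 := angle_mono hlt.le
    rw [hqϑ] at h1
    have := mul_nonneg hDn.le (sub_nonneg.mpr h1)
    linarith
  have hc := core q hq0 hq1 (by rw [hqϑ]; simp) (by rw [hqϑ]; simpa using hL)
  have hU0 : U (D * n * (angle p - ϑ)) = U (D * n * (angle q - ϑ)) := by
    rw [hqϑ, sub_self, mul_zero, hU, profile, profile, max_eq_right hneg.le, max_self]
  rw [hU0]
  refine hc.trans ?_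
  have hmono : ∀ x y : ℝ, x ≤ y → U (D * (n + 1) * (angle (y / (n + 1)) - ϑ')) ≤
      U (D * (n + 1) * (angle (x / (n + 1)) - ϑ')) := by
    intro x y hxy
    refine hanti ?_
    have : angle (x / (n + 1)) ≤ angle (y / (n + 1)) := angle_mono (by gcongr)
    gcongr
  have m1 := hmono (n * p + 1) (n * q + 1) (by gcongr)
  have m0 := hmono (n * p) (n * q) (by gcongr)
  have m2 := hmono (n * q) (n * q + 1) (by linarith)
  generalize U (D * (n + 1) * (angle ((n * q + 1) / (n + 1)) - ϑ')) = a1 at *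
  generalize U (D * (n + 1) * (angle (n * q / (n + 1)) - ϑ')) = a0 at *
  have h1 := mul_le_mul_of_nonneg_left m1 hp0
  have h0 := mul_le_mul_of_nonneg_left m0 (by linarith : 0 ≤ 1 - p)
  nlinarith [mul_nonneg (sub_nonneg.mpr hpq) (sub_nonneg.mpr m2)]

/-! ### The warm-up phase -/

/-- A martingale bound for the event that the mean exceeds `b - δ` or that the empirical mean
after `n₀` samples exceeds the mean by `δ`. -/
def deviation (b δ : ℝ) (n₀ : ℕ) (x : ℝ) (S k : ℕ) : ℝ :=
  Set.indicator (Set.Ioi (b - δ)) (fun _ => 1) x +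
    ((S - (S + k) * x) ^ 2 + (n₀ - (S + k)) * (x * (1 - x))) / (n₀ * δ) ^ 2

/-- The likelihood of the data, averaged over the reservoir and corrected by the deviation. -/
def warmup (μ : Measure I) (b δ : ℝ) (n₀ : ℕ) (S k : ℕ) : ℝ :=
  ∫ x : I, likelihood x S k * (1 - deviation b δ n₀ x S k) ∂μ

section Warmup

variable {μ : Measure I} {b δ : ℝ} {n₀ : ℕ}

lemma integrable_of_continuous [IsFiniteMeasure μ] {f : I → ℝ} (hf : Continuous f) :
    Integrable f μ :=
  hf.integrable_of_hasCompactSupport (HasCompactSupport.of_compactSpace f)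

lemma integrable_likelihood [IsFiniteMeasure μ] (S k : ℕ) :
    Integrable (fun x : I => likelihood x S k) μ :=
  integrable_of_continuous ((continuous_likelihood S k).comp continuous_subtype_val)

lemma integrable_warmup [IsFiniteMeasure μ] (S k : ℕ) :
    Integrable (fun x : I => likelihood x S k * (1 - deviation b δ n₀ x S k)) μ := by
  have hlik : Continuous fun x : I => likelihood x S k :=
    (continuous_likelihood S k).comp continuous_subtype_val
  have h1 : Integrable (fun x : I => likelihood x S k * (1 -
      ((S - (S + k) * (x : ℝ)) ^ 2 + (n₀ - (S + k)) * (x * (1 - x))) / (n₀ * δ) ^ 2)) μ :=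
    integrable_of_continuous (by fun_prop)
  have h2 : Integrable (Set.indicator {x : I | b - δ < x} fun x : I => likelihood x S k) μ :=
    (integrable_likelihood S k).indicator
      (measurableSet_lt measurable_const measurable_subtype_coe)
  refine (h1.sub h2).congr (ae_of_all _ fun x => ?_)
  by_cases hx : b - δ < x
  · simp [deviation, hx]; ring
  · simp [deviation, hx]

/-- For fixed `x` the deviation is a martingale under Bernoulli(`x`) sampling: its quadratic part is
the conditional expectation of `(S - n₀ x)² / (n₀ δ)²` at time `n₀`. -/
lemma warmup_add [IsFiniteMeasure μ] (S k : ℕ) :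
    warmup μ b δ n₀ (S + 1) k + warmup μ b δ n₀ S (k + 1) = warmup μ b δ n₀ S k := by
  rw [warmup, warmup, warmup, ← integral_add (integrable_warmup _ _) (integrable_warmup _ _)]
  refine integral_congr_ae (ae_of_all _ fun x => ?_)
  simp only [deviation, likelihood, pow_succ, div_eq_mul_inv]
  generalize (Set.Ioi (b - δ)).indicator (fun _ => (1 : ℝ)) (x : ℝ) = A
  push_cast
  ring

lemma deviation_nonneg {x : ℝ} (h0 : 0 ≤ x) (h1 : x ≤ 1) {S k : ℕ} (hm : S + k ≤ n₀) :
    0 ≤ deviation b δ n₀ x S k := by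
  have hm' : (S + k : ℝ) ≤ n₀ := by exact_mod_cast hm
  refine add_nonneg (Set.indicator_nonneg (fun _ _ => zero_le_one) _) ?_
  refine div_nonneg (add_nonneg (sq_nonneg _) ?_) (sq_nonneg _)
  exact mul_nonneg (by linarith) (mul_nonneg h0 (by linarith))

lemma warmup_le_integral_likelihood [IsFiniteMeasure μ] {S k : ℕ} (hm : S + k ≤ n₀) :
    warmup μ b δ n₀ S k ≤ ∫ x : I, likelihood x S k ∂μ := by
  refine integral_mono (integrable_warmup _ _) (integrable_likelihood _ _) fun x => ?_
  have h1 := likelihood_nonneg x.2.1 x.2.2 S k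
  have h2 := deviation_nonneg (b := b) (δ := δ) x.2.1 x.2.2 hm
  simp only
  nlinarith

lemma warmup_le_mul_uniformMix [IsProbabilityMeasure μ] {S k : ℕ} (hm : S + k ≤ n₀) :
    warmup μ b δ n₀ S k ≤ (S + k + 1) * uniformMix S k := by
  refine (warmup_le_integral_likelihood hm).trans ?_
  calc ∫ x : I, likelihood x S k ∂μ ≤ ∫ _ : I, (S + k + 1) * uniformMix S k ∂μ :=
        integral_mono (integrable_likelihood _ _) (integrable_const _) fun x =>
          likelihood_le_mul_uniformMix x.2.1 x.2.2 S k
    _ = _ := by simp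

/-- Data with a high empirical mean at time `n₀` get no weight, so the main phase need not dominate
anything above its starting boundary. -/
lemma warmup_nonpos (hδ : 0 < δ) {S k : ℕ} (hm : S + k = n₀) (hn₀ : 0 < n₀)
    (hS : b * n₀ ≤ S) : warmup μ b δ n₀ S k ≤ 0 := by
  refine integral_nonpos fun x => ?_
  have h1 := likelihood_nonneg x.2.1 x.2.2 S k
  have hn : (0 : ℝ) < n₀ := by exact_mod_cast hn₀
  have hm' : (S + k : ℝ) = n₀ := by exact_mod_cast hm
  have h2 : 1 ≤ deviation b δ n₀ x S k := by
    rw [deviation, hm', sub_self, zero_mul, add_zero]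
    by_cases hx : b - δ < x
    · rw [Set.indicator_of_mem (by exact hx)]
      have : 0 ≤ (S - n₀ * (x : ℝ)) ^ 2 / (n₀ * δ) ^ 2 := by positivity
      linarith
    · rw [Set.indicator_of_notMem (by exact hx), zero_add, le_div_iff₀ (by positivity), one_mul]
      push Not at hx
      refine pow_le_pow_left₀ (by positivity) ?_ 2
      nlinarith
  exact mul_nonpos_of_nonneg_of_nonpos h1 (by linarith)

lemma le_warmup_zero [IsProbabilityMeasure μ] {ε : ℝ} (hε : 0 ≤ ε) (hδ : 0 < δ) (hn₀ : 0 < n₀)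
    (hμ : μ {x : I | b - δ < x} ≤ ENNReal.ofReal ε) :
    1 - (ε + 1 / (n₀ * δ ^ 2)) ≤ warmup μ b δ n₀ 0 0 := by
  have hn : (0 : ℝ) < n₀ := by exact_mod_cast hn₀
  have hms : MeasurableSet {x : I | b - δ < x} :=
    measurableSet_lt measurable_const measurable_subtype_coe
  have hind : Integrable ({x : I | b - δ < x}.indicator fun _ => (1 : ℝ)) μ :=
    (integrable_const _).indicator hms
  have hle : ∫ x : I, ((1 - 1 / (n₀ * δ ^ 2)) - {x : I | b - δ < x}.indicator (fun _ => (1 : ℝ)) x) ∂μ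
      ≤ warmup μ b δ n₀ 0 0 := by
    refine integral_mono ((integrable_const _).sub hind) (integrable_warmup _ _) fun x => ?_
    have hq : (n₀ : ℝ) * (x * (1 - x)) / (n₀ * δ) ^ 2 ≤ 1 / (n₀ * δ ^ 2) := by
      rw [div_le_div_iff₀ (by positivity) (by positivity)]
      have : (x : ℝ) * (1 - x) ≤ 1 := by nlinarith [x.2.1, x.2.2]
      calc (n₀ : ℝ) * (x * (1 - x)) * (n₀ * δ ^ 2) = (x * (1 - x)) * (n₀ * δ) ^ 2 := by ring
        _ ≤ _ := by gcongr
    have hi : (Set.Ioi (b - δ)).indicator (fun _ => (1 : ℝ)) (x : ℝ) =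
        {x : I | b - δ < x}.indicator (fun _ => (1 : ℝ)) x := by
      by_cases hx : b - δ < x
      · simp [hx]
      · simp [hx]
    simp only [deviation, likelihood, hi, pow_zero, mul_one, one_mul, Nat.cast_zero, zero_mul,
      zero_add, sub_zero]
    norm_num
    norm_num at hq
    linarith
  refine le_trans ?_ hle
  rw [integral_sub (integrable_const _) hind, integral_indicator hms]
  have : μ.real {x : I | b - δ < x} ≤ ε := ENNReal.toReal_le_of_le_ofReal hε hμ
  simp
  norm_num at *
  linarith

end Warmup

lemma lintegral_armLik_eq (μ : Measure I) [IsFiniteMeasure μ] (S k : ℕ) :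
    ∫⁻ x, armLik x S k ∂μ = ENNReal.ofReal (∫ x : I, likelihood x S k ∂μ) := by
  rw [ofReal_integral_eq_lintegral_ofReal (integrable_likelihood S k)
    (ae_of_all _ fun x => likelihood_nonneg x.2.1 x.2.2 S k)]
  simp only [armLik_eq_ofReal]

lemma lintegral_armLik_le_one (μ : Measure I) [IsProbabilityMeasure μ] (S k : ℕ) :
    ∫⁻ x, armLik x S k ∂μ ≤ 1 := by
  calc ∫⁻ x, armLik x S k ∂μ ≤ ∫⁻ _, 1 ∂μ := lintegral_mono fun x =>
        mul_le_one' (pow_le_one' (PMF.coe_le_one _ _) _) (pow_le_one' (PMF.coe_le_one _ _) _)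
    _ = 1 := by simp

/-! ### The one-arm subsolution -/

/-- The parameters of the subsolution: the cutoff `L` and slack `lam` of the profile, the drift
`D`, the length `n₀` and margin `δ` of the warm-up phase, the starting angle `Θ` and the
prefactor `c`. -/
structure Params where
  lam : ℝ
  L : ℝ
  D : ℝ
  δ : ℝ
  Θ : ℝ
  c : ℝ
  n₀ : ℕ

namespace Params

variable (P : Params)

/-- The exponential loss per sample. -/
def loss : ℝ := (1 + P.lam) * P.D ^ 2 / 2

/-- The profile of the main phase. -/
def prof (ξ : ℝ) : ℝ := profile (P.lam / 2) (Real.exp (-(P.lam / 2 * P.L ^ 2 / 2))) ξ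

/-- The drifting boundary, as an angle. -/
def boundary (n : ℝ) : ℝ := P.Θ - P.D * Real.log (n / (P.n₀ + 2))

/-- The scaled distance to the boundary. -/
def dist (S k : ℕ) : ℝ :=
  P.D * (S + k + 2) * (angle ((S + 1) / (S + k + 2)) - P.boundary (S + k + 2))

/-- The subsolution in the main phase. -/
def main (S k : ℕ) : ℝ := P.c * uniformMix S k * P.prof (P.dist S k)

/-- The subsolution. -/
def subsol (μ : Measure I) (b : ℝ) (S k : ℕ) : ℝ :=
  if S + k = 0 then 1
  else if S + k ≤ P.n₀ then
    (1 - P.loss / 2) ^ (S + k) * max 0 (warmup μ b P.δ P.n₀ S k)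
  else P.main S k

variable {P}

lemma main_nonneg (hc : 0 ≤ P.c) (S k : ℕ) : 0 ≤ P.main S k :=
  mul_nonneg (mul_nonneg hc (uniformMix_pos S k).le) (profile_nonneg _ _ _)

lemma subsol_nonneg (hc : 0 ≤ P.c) (hloss : P.loss ≤ 1) (μ : Measure I) (b : ℝ) (S k : ℕ) :
    0 ≤ P.subsol μ b S k := by
  unfold subsol
  split_ifs
  · exact zero_le_one
  · exact mul_nonneg (pow_nonneg (by linarith) _) (le_max_left _ _)
  · exact main_nonneg hc S k

/-- From `1/(n+1) ≤ log ((n+1)/n) ≤ 1/n`; these are the drift conditions in `exists_urn_step`. -/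
lemma mul_log_div_mem (hD : 0 ≤ P.D) {n : ℝ} (hn : 0 < n) :
    P.D ≤ (n + 1) * (P.boundary n - P.boundary (n + 1)) ∧
      (n + 1) * (P.boundary n - P.boundary (n + 1)) ≤ P.D * (1 + 1 / n) := by
  have h0 : (0 : ℝ) < P.n₀ + 2 := by positivity
  have e : P.boundary n - P.boundary (n + 1) = P.D * Real.log ((n + 1) / n) := by
    rw [boundary, boundary, Real.log_div hn.ne' h0.ne', Real.log_div (by positivity) h0.ne',
      Real.log_div (by positivity) hn.ne']
    ring
  have h1 : Real.log ((n + 1) / n) ≤ 1 / n := by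
    have := Real.log_le_sub_one_of_pos (x := (n + 1) / n) (by positivity)
    refine this.trans (le_of_eq ?_)
    field_simp; ring
  have h2 : 1 / (n + 1) ≤ Real.log ((n + 1) / n) := by
    have := Real.one_sub_inv_le_log_of_pos (x := (n + 1) / n) (by positivity)
    refine le_trans (le_of_eq ?_) this
    field_simp; ring
  rw [e]
  constructor
  · calc P.D = (n + 1) * (P.D * (1 / (n + 1))) := by field_simp
      _ ≤ _ := by gcongr
  · calc (n + 1) * (P.D * Real.log ((n + 1) / n)) ≤ (n + 1) * (P.D * (1 / n)) := by gcongr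
      _ = _ := by field_simp

lemma boundary_antitone (hD : 0 ≤ P.D) {n n' : ℝ} (hn : 0 < n) (h : n ≤ n') :
    P.boundary n' ≤ P.boundary n := by
  unfold boundary
  gcongr

lemma boundary_start : P.boundary (P.n₀ + 2) = P.Θ := by
  have : (P.n₀ + 2 : ℝ) ≠ 0 := by positivity
  rw [boundary, div_self this, Real.log_one, mul_zero, sub_zero]

/-- Where the subsolution of the main phase is positive, the empirical mean is at most slightly
above the boundary. -/
lemma angle_lt_of_main_ne_zero (hlam : 0 < P.lam) (hL : 0 ≤ P.L) (hD : 0 < P.D) {S k : ℕ}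
    (h : P.main S k ≠ 0) :
    angle ((S + 1) / (S + k + 2)) < P.boundary (S + k + 2) + P.L / (P.D * (S + k + 2)) := by
  by_contra hge
  push Not at hge
  apply h
  have hn : (0 : ℝ) < S + k + 2 := by positivity
  have hLd : P.L ≤ P.dist S k := by
    unfold dist
    calc P.L = P.D * (S + k + 2) * (P.L / (P.D * (S + k + 2))) := by field_simp
      _ ≤ _ := by gcongr; linarith
  rw [main, prof, profile_of_ge (by positivity) hL hLd, mul_zero]

lemma main_le (hlam : 0 < P.lam) (hc : 0 ≤ P.c) (S k : ℕ) :
    P.main S k ≤ P.c * uniformMix S k :=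
  mul_le_of_le_one_right (mul_nonneg hc (uniformMix_pos S k).le)
    (profile_le_one (by positivity) (Real.exp_pos _).le _)

/-- One step in the main phase. -/
lemma main_step (hc : 0 ≤ P.c) {S k : ℕ}
    (h : (1 - P.loss) * P.prof (P.dist S k) ≤
      ((S + 1) / (S + k + 2) : ℝ) * P.prof (P.dist (S + 1) k) +
        (1 - (S + 1) / (S + k + 2) : ℝ) * P.prof (P.dist S (k + 1))) :
    (1 - P.loss) * P.main S k ≤ P.main (S + 1) k + P.main S (k + 1) := by
  have hg := (uniformMix_pos S k).le
  calc (1 - P.loss) * P.main S k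
      = P.c * uniformMix S k * ((1 - P.loss) * P.prof (P.dist S k)) := by rw [main]; ring
    _ ≤ P.c * uniformMix S k * _ := mul_le_mul_of_nonneg_left h (mul_nonneg hc hg)
    _ = _ := by rw [main, main, uniformMix_succ_left, uniformMix_succ_right]; ring

/-- The conditions under which `subsol` is a subsolution up to time `N`. -/
structure Valid (P : Params) (N : ℕ) (l m ν : ℝ) : Prop where
  lam_pos : 0 < P.lam
  L_nonneg : 0 ≤ P.L
  D_pos : 0 < P.D
  δ_pos : 0 < P.δ
  c_nonneg : 0 ≤ P.c
  n₀_pos : 0 < P.n₀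
  loss_le : P.loss ≤ 1
  step : ∀ n : ℝ, 0 < n → 1 ≤ ν * P.D ^ 2 * n →
      ∀ p ϑ ϑ' : ℝ, 0 ≤ p → p ≤ 1 → angle l ≤ ϑ → ϑ ≤ angle m → P.D ≤ (n + 1) * (ϑ - ϑ') →
      (n + 1) * (ϑ - ϑ') ≤ P.D * (1 + 1 / n) →
      (1 - P.loss) * P.prof (P.D * n * (angle p - ϑ)) ≤
        p * P.prof (P.D * (n + 1) * (angle ((n * p + 1) / (n + 1)) - ϑ')) +
        (1 - p) * P.prof (P.D * (n + 1) * (angle (n * p / (n + 1)) - ϑ'))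
  n₀_large : 1 ≤ ν * P.D ^ 2 * P.n₀
  ν_pos : 0 < ν
  le_boundary : angle l ≤ P.boundary (N + 2)
  Θ_le : P.Θ ≤ angle m
  -- The decay accumulated in the warm-up pays for the prefactor `c` and for the factor `n₀ + 1`
  -- lost in comparing the reservoir with `uniformMix`. The last factor is the profile on and below
  -- the boundary.
  transition : (1 - P.loss / 2) ^ P.n₀ * (P.n₀ + 1) ≤
    P.c * (1 - Real.exp (-(P.lam / 2 * P.L ^ 2 / 2)))

variable {N : ℕ} {l m ν : ℝ}

lemma Valid.main_step (hP : P.Valid N l m ν) {S k : ℕ} (h0 : P.n₀ ≤ S + k) (hN : S + k < N) :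
    (1 - P.loss) * P.main S k ≤ P.main (S + 1) k + P.main S (k + 1) := by
  apply Params.main_step hP.c_nonneg
  have hn : (0 : ℝ) < S + k + 2 := by positivity
  have h0' : (P.n₀ : ℝ) ≤ S + k := by exact_mod_cast h0
  have hN' : (S + k : ℝ) + 1 ≤ N := by exact_mod_cast hN
  have hD := hP.D_pos
  have hν := hP.ν_pos
  have hb1 : angle l ≤ P.boundary (S + k + 2) :=
    hP.le_boundary.trans (boundary_antitone hD.le hn (by linarith))
  have hb2 : P.boundary (S + k + 2) ≤ angle m := by
    refine le_trans ?_ hP.Θ_le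
    rw [← boundary_start]
    exact boundary_antitone hD.le (by positivity) (by linarith)
  have hd := mul_log_div_mem (P := P) hD.le hn
  have := hP.step (S + k + 2) hn
    (hP.n₀_large.trans (by gcongr; linarith))
    ((S + 1) / (S + k + 2)) (P.boundary (S + k + 2)) (P.boundary (S + k + 2 + 1))
    (by positivity) (by rw [div_le_one hn]; have : (0 : ℝ) ≤ k := Nat.cast_nonneg k; linarith)
    hb1 hb2 hd.1 hd.2
  refine this.trans (le_of_eq ?_)
  unfold dist
  have e1 : (((S : ℝ) + k + 2) * ((S + 1) / (S + k + 2)) + 1) / (S + k + 2 + 1) =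
      (((S + 1 : ℕ) : ℝ) + 1) / (((S + 1 : ℕ) : ℝ) + k + 2) := by
    push_cast
    rw [mul_div_cancel₀ _ hn.ne']
    congr 1; ring
  have e2 : (((S : ℝ) + k + 2) * ((S + 1) / (S + k + 2))) / (S + k + 2 + 1) =
      ((S : ℝ) + 1) / (S + ((k + 1 : ℕ) : ℝ) + 2) := by
    push_cast
    rw [mul_div_cancel₀ _ hn.ne']
    congr 1; ring
  rw [e1, e2]
  have e3 : (S : ℝ) + k + 2 + 1 = ((S + 1 : ℕ) : ℝ) + k + 2 := by push_cast; ring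
  have e4 : (S : ℝ) + k + 2 + 1 = S + ((k + 1 : ℕ) : ℝ) + 2 := by push_cast; ring
  congr 2
  · rw [e3]
  · rw [e4]

/-- At the end of the warm-up phase the main phase takes over. -/
lemma Valid.warmup_le_main (hP : P.Valid N l m ν) {μ : Measure I} [IsProbabilityMeasure μ]
    {b : ℝ} (hb : ∀ S k : ℕ, S + k = P.n₀ → (S : ℝ) < b * P.n₀ →
      angle ((S + 1) / (S + k + 2)) ≤ P.Θ) {S k : ℕ} (hm : S + k = P.n₀) :
    (1 - P.loss / 2) ^ (S + k) * max 0 (warmup μ b P.δ P.n₀ S k) ≤ P.main S k := by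
  have hloss := hP.loss_le
  have hpow : 0 ≤ (1 - P.loss / 2) ^ (S + k) := pow_nonneg (by linarith) _
  rcases le_or_gt (b * P.n₀) S with h | h
  · rw [max_eq_left (warmup_nonpos hP.δ_pos hm hP.n₀_pos h), mul_zero]
    exact main_nonneg hP.c_nonneg S k
  have hmR : (S + k : ℝ) = P.n₀ := by exact_mod_cast hm
  have hdist : P.dist S k ≤ 0 := by
    have := hb S k hm h
    unfold dist
    rw [hmR] at this ⊢
    rw [boundary_start]
    have hD := hP.D_pos
    exact mul_nonpos_of_nonneg_of_nonpos (by positivity) (by linarith)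
  have hlam := hP.lam_pos
  have hprof : P.prof (P.dist S k) = 1 - Real.exp (-(P.lam / 2 * P.L ^ 2 / 2)) := by
    refine profile_of_nonpos ?_ hdist
    rw [Real.exp_le_one_iff]
    have : 0 ≤ P.lam / 2 * P.L ^ 2 / 2 := by positivity
    linarith
  have hg := (uniformMix_pos S k).le
  calc (1 - P.loss / 2) ^ (S + k) * max 0 (warmup μ b P.δ P.n₀ S k)
      ≤ (1 - P.loss / 2) ^ (S + k) * ((S + k + 1) * uniformMix S k) := by
        refine mul_le_mul_of_nonneg_left (max_le ?_ (warmup_le_mul_uniformMix hm.le)) hpow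
        exact mul_nonneg (by positivity) hg
    _ = ((1 - P.loss / 2) ^ P.n₀ * (P.n₀ + 1)) * uniformMix S k := by rw [hm, hmR]; ring
    _ ≤ (P.c * (1 - Real.exp (-(P.lam / 2 * P.L ^ 2 / 2)))) * uniformMix S k :=
        mul_le_mul_of_nonneg_right hP.transition hg
    _ = P.main S k := by rw [main, hprof]; ring

lemma Valid.subsol_step (hP : P.Valid N l m ν) {μ : Measure I} [IsProbabilityMeasure μ]
    {b : ℝ} (hb : ∀ S k : ℕ, S + k = P.n₀ → (S : ℝ) < b * P.n₀ →
      angle ((S + 1) / (S + k + 2)) ≤ P.Θ)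
    (h0 : 1 - P.loss / 2 ≤ warmup μ b P.δ P.n₀ 0 0) {S k : ℕ} (hN : S + k < N) :
    (1 - P.loss) * P.subsol μ b S k ≤ P.subsol μ b (S + 1) k + P.subsol μ b S (k + 1) := by
  have hloss := hP.loss_le
  have hn₀ := hP.n₀_pos
  have hloss0 : 0 ≤ P.loss := by have := hP.lam_pos; unfold loss; positivity
  have hhalf : 0 ≤ 1 - P.loss / 2 := by linarith
  have hs : S + 1 + k = S + k + 1 := by ring
  have hs' : S + (k + 1) = S + k + 1 := by ring
  have hmax : max 0 (warmup μ b P.δ P.n₀ S k) ≤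
      max 0 (warmup μ b P.δ P.n₀ (S + 1) k) + max 0 (warmup μ b P.δ P.n₀ S (k + 1)) := by
    refine max_le (add_nonneg (le_max_left _ _) (le_max_left _ _)) ?_
    rw [← warmup_add]
    exact add_le_add (le_max_right _ _) (le_max_right _ _)
  rcases Nat.eq_zero_or_pos (S + k) with hz | hpos
  · obtain ⟨rfl, rfl⟩ : S = 0 ∧ k = 0 := by omega
    have hle : 0 + 1 + 0 ≤ P.n₀ := hn₀
    simp only [subsol, hle, if_true]
    have h1 := (le_max_right 0 _).trans hmax
    norm_num at h1 ⊢
    rw [← sub_le_iff_le_add]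
    -- The first sample pays twice: half of the loss is the warm-up decay, the other half covers the
    -- gap between `1` and `warmup` at the start.
    calc 1 - P.loss ≤ (1 - P.loss / 2) * (1 - P.loss / 2) := by nlinarith [sq_nonneg P.loss]
      _ ≤ (1 - P.loss / 2) * warmup μ b P.δ P.n₀ 0 0 := by gcongr
      _ ≤ (1 - P.loss / 2) * _ := by gcongr
      _ = _ := mul_add _ _ _
  have hne : S + k ≠ 0 := hpos.ne'
  rcases lt_trichotomy (S + k) P.n₀ with hlt | heq | hgt
  · have hle : S + k ≤ P.n₀ := hlt.le
    have hle' : S + k + 1 ≤ P.n₀ := hlt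
    simp only [subsol, hs, hs', hle, hle', hne, if_true, if_false, Nat.succ_ne_zero]
    rw [pow_succ]
    have hp : 0 ≤ (1 - P.loss / 2) ^ (S + k) := pow_nonneg hhalf _
    calc (1 - P.loss) * ((1 - P.loss / 2) ^ (S + k) * max 0 (warmup μ b P.δ P.n₀ S k))
        ≤ (1 - P.loss / 2) * ((1 - P.loss / 2) ^ (S + k) * max 0 (warmup μ b P.δ P.n₀ S k)) := by
          refine mul_le_mul_of_nonneg_right (by linarith) (mul_nonneg hp (le_max_left _ _))
      _ = (1 - P.loss / 2) ^ (S + k) * (1 - P.loss / 2) * max 0 (warmup μ b P.δ P.n₀ S k) := by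
          ring
      _ ≤ (1 - P.loss / 2) ^ (S + k) * (1 - P.loss / 2) * _ := by gcongr
      _ = _ := mul_add _ _ _
  · have hle : S + k ≤ P.n₀ := heq.le
    have hnle : ¬ S + k + 1 ≤ P.n₀ := by omega
    simp only [subsol, hs, hs', hle, hnle, hne, if_true, if_false, Nat.succ_ne_zero]
    refine le_trans ?_ (hP.main_step heq.ge hN)
    exact mul_le_mul_of_nonneg_left (hP.warmup_le_main hb heq) (by linarith)
  · have hnle : ¬ S + k ≤ P.n₀ := by omega
    have hnle' : ¬ S + k + 1 ≤ P.n₀ := by omega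
    simp only [subsol, hs, hs', hnle, hnle', hne, if_false, Nat.succ_ne_zero]
    exact hP.main_step hgt.le hN

end Params

/-! ### Failure bound for admissible parameters -/

namespace Params

variable {P : Params} {N : ℕ} {l m ν : ℝ}

lemma Valid.empirical_lt (hP : P.Valid N l m ν) {q : ℝ} {n : ℝ} (hn : 0 < n) {S k : ℕ}
    (hm : n ≤ S + k) (h : P.main S k ≠ 0)
    (hq : P.boundary (n + 2) + P.L / (P.D * (n + 2)) ≤ angle q) :
    ((S : ℝ) + 1) / (S + k + 2) < q := by
  have hD := hP.D_pos
  have hL := hP.L_nonneg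
  have h1 := angle_lt_of_main_ne_zero hP.lam_pos hL hD h
  have h2 : P.boundary (S + k + 2) ≤ P.boundary (n + 2) :=
    boundary_antitone hD.le (by linarith) (by linarith)
  have h3 : P.L / (P.D * (S + k + 2)) ≤ P.L / (P.D * (n + 2)) := by gcongr
  by_contra hge
  push Not at hge
  have := angle_mono hge
  linarith

/-- Passes from the urn proportion to the right end of the window used in
`ofReal_mul_uniformMix_le`. -/
lemma half_div_lt {S k : ℕ} {q r : ℝ} (h : ((S : ℝ) + 1) / (S + k + 2) < q) (hq : q ≤ 1)
    (hr : 3 / 2 ≤ (r - q) * (S + k)) (hm : 0 < S + k) : ((S : ℝ) + 1 / 2) / (S + k) < r := by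
  have hm' : (0 : ℝ) < S + k := by exact_mod_cast hm
  rw [div_lt_iff₀ (by positivity)] at h
  rw [div_lt_iff₀ hm']
  linarith

/-- The failure probability of any algorithm under the reservoir, for valid parameters. -/
theorem Valid.le_failureProb (hP : P.Valid N l m ν) {α a : I} {w β β' : ℝ} {T : ℕ}
    (hw : 0 < w) (hw1 : w < 1) (hα : (0 : ℝ) < α) (ha1 : (a : ℝ) < 1) (hβ : 0 < β) (hβa : β < a)
    (hβ'β : β' < β) (hc : P.c * (4 * N) ≤ w) (hαδ : α ≤ (a : ℝ) - 2 * P.δ)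
    (hV : w / a * (2 * P.δ) + 1 / (P.n₀ * P.δ ^ 2) ≤ P.loss / 2)
    (hΘ : P.Θ = angle (a - P.δ / 2)) (hδn : 8 ≤ P.δ * P.n₀)
    (hL : P.L / (P.D * (P.n₀ + 2)) ≤ P.δ / 2) (hT : P.n₀ ≤ T)
    (hTβ : P.boundary (T + 2) + P.L / (P.D * (T + 2)) ≤ angle β') (hTβ' : 2 ≤ (β - β') * T)
    (A : Algorithm) :
    ENNReal.ofReal (w * (β / 4)) * ENNReal.ofReal (β / 4) ^ T * ENNReal.ofReal (1 - P.loss) ^ N ≤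
      failureProb (reservoir α a w) A N β := by
  have hδ := hP.δ_pos
  have hn₀ := hP.n₀_pos
  have hn₀' : (0 : ℝ) < P.n₀ := by exact_mod_cast hn₀
  have ha : (0 : ℝ) < a := hβ.trans hβa
  have hcn := hP.c_nonneg
  have hloss := hP.loss_le
  have hloss0 : 0 ≤ P.loss := by have := hP.lam_pos; unfold loss; positivity
  have := isProbabilityMeasure_reservoir (α := α) ha hw hw1
  set μ := reservoir α a w with hμ
  have h0 : 1 - P.loss / 2 ≤ warmup μ (a - P.δ) P.δ P.n₀ 0 0 := by
    have hle : μ {x : I | (a : ℝ) - P.δ - P.δ < x} ≤ ENNReal.ofReal (w / a * (2 * P.δ)) := by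
      set c : I := ⟨(a : ℝ) - 2 * P.δ, by linarith, by linarith⟩
      have h1 := reservoir_Ioi_le (α := α) (a := a) hw.le (c := c) (Subtype.coe_le_coe.mp hαδ)
      have e : {x : I | (a : ℝ) - P.δ - P.δ < x} = Set.Ioi c := by
        ext x
        simp only [Set.mem_ofPred_eq, Set.mem_Ioi, ← Subtype.coe_lt_coe, c]
        constructor <;> intro h <;> linarith
      rw [e]
      refine h1.trans (le_of_eq ?_)
      congr 2
      simp only [c]; ring
    have h2 := le_warmup_zero (n₀ := P.n₀) (by positivity) hδ hn₀ hle
    linarith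
  have hb : ∀ S k : ℕ, S + k = P.n₀ → (S : ℝ) < ((a : ℝ) - P.δ) * P.n₀ →
      angle ((S + 1) / (S + k + 2)) ≤ P.Θ := by
    intro S k hm hS
    have hmR : (S + k : ℝ) = P.n₀ := by exact_mod_cast hm
    rw [hΘ, hmR]
    apply angle_mono
    rw [div_le_iff₀ (by positivity)]
    nlinarith
  -- On the support of the main phase the likelihood window lies in `[0, a]`, where the reservoir
  -- has a density.
  have hlow : ∀ S k : ℕ, P.n₀ ≤ S + k → P.main S k ≠ 0 → ((S : ℝ) + 1 / 2) / (S + k) < a := by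
    intro S k hm hne
    have hmR : (P.n₀ : ℝ) ≤ S + k := by exact_mod_cast hm
    have hq : P.boundary (P.n₀ + 2) + P.L / (P.D * (P.n₀ + 2)) ≤ angle (a - P.δ / 4) := by
      rw [boundary_start, hΘ]
      have := two_mul_sub_le_angle_sub (x := a - P.δ / 2) (y := a - P.δ / 4) (by linarith)
        (by linarith) (by linarith)
      linarith
    refine half_div_lt (hP.empirical_lt hn₀' hmR hne hq) (by linarith) ?_ (by omega)
    nlinarith
  -- From `T` samples on, the boundary has sunk below `β'`, so the whole window consists of bad
  -- means and restricting to them loses nothing.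
  have hlowβ : ∀ S k : ℕ, T ≤ S + k → P.main S k ≠ 0 → ((S : ℝ) + 1 / 2) / (S + k) < β := by
    intro S k hm hne
    have hmR : (T : ℝ) ≤ S + k := by exact_mod_cast hm
    have hT0 : (0 : ℝ) < T := hn₀'.trans_le (by exact_mod_cast hT)
    refine half_div_lt (hP.empirical_lt hT0 hmR hne hTβ) (by linarith) ?_ (by omega)
    nlinarith
  have hmain : ∀ S k : ℕ, 0 < S + k → S + k ≤ N →
      P.main S k ≤ w / (4 * (S + k)) * uniformMix S k := by
    intro S k hpos hN
    refine (main_le hP.lam_pos hcn S k).trans ?_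
    have hg := (uniformMix_pos S k).le
    refine mul_le_mul_of_nonneg_right ?_ hg
    have hpos' : (0 : ℝ) < S + k := by exact_mod_cast hpos
    have hN' : (S + k : ℝ) ≤ N := by exact_mod_cast hN
    rw [le_div_iff₀ (by positivity)]
    refine le_trans ?_ hc
    gcongr
  have hle : ∀ S k, S + k ≤ N → ENNReal.ofReal (P.subsol μ (a - P.δ) S k) ≤
      ∫⁻ x, armLik x S k ∂μ := by
    intro S k hN
    unfold subsol
    split_ifs with h1 h2
    · obtain ⟨rfl, rfl⟩ : S = 0 ∧ k = 0 := by omega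
      simp [armLik_zero]
    · rw [lintegral_armLik_eq]
      apply ENNReal.ofReal_le_ofReal
      have hint : 0 ≤ ∫ x : I, likelihood x S k ∂μ :=
        integral_nonneg fun x => likelihood_nonneg x.2.1 x.2.2 S k
      have hw2 := warmup_le_integral_likelihood (μ := μ) (b := a - P.δ) (δ := P.δ) h2
      calc (1 - P.loss / 2) ^ (S + k) * max 0 (warmup μ (a - P.δ) P.δ P.n₀ S k)
          ≤ 1 * max 0 (warmup μ (a - P.δ) P.δ P.n₀ S k) := by
            refine mul_le_mul_of_nonneg_right ?_ (le_max_left _ _)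
            exact pow_le_one₀ (by linarith) (by linarith)
        _ ≤ _ := by rw [one_mul]; exact max_le hint hw2
    · by_cases hne : P.main S k = 0
      · simp [hne]
      refine (ENNReal.ofReal_le_ofReal (hmain S k (by omega) hN)).trans ?_
      have := ofReal_mul_uniformMix_le (α := α) ha hw.le (S := S) (k := k) (by omega)
        (hlow S k (by omega) hne).le (s := Set.univ) fun x _ => Set.mem_univ x
      rwa [Measure.restrict_univ] at this
  refine mul_pow_le_failureProb μ A N β
    (F := fun S k => ENNReal.ofReal (P.subsol μ (a - P.δ) S k)) ?_ ?_ hle ?_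
  · simp [subsol]
  · intro S k hN
    have hst := hP.subsol_step hb h0 hN
    rw [← ENNReal.ofReal_mul (by linarith),
      ← ENNReal.ofReal_add (subsol_nonneg hcn hloss _ _ _ _) (subsol_nonneg hcn hloss _ _ _ _)]
    exact ENNReal.ofReal_le_ofReal hst
  · intro S k hN
    have hβ1 : ENNReal.ofReal (β / 4) ≤ 1 := by
      rw [ENNReal.ofReal_le_one]; linarith
    -- An arm with few samples is charged `(β/4)^T` outright; an arm with many samples satisfies the
    -- bound with constant 1.
    rcases le_or_gt (S + k) T with hm | hm
    · calc ENNReal.ofReal (w * (β / 4)) * ENNReal.ofReal (β / 4) ^ T *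
            ENNReal.ofReal (P.subsol μ (a - P.δ) S k)
          ≤ ENNReal.ofReal (w * (β / 4)) * ENNReal.ofReal (β / 4) ^ (S + k) * 1 := by
            refine mul_le_mul' (mul_le_mul' le_rfl (pow_le_pow_right_of_le_one' hβ1 hm)) ?_
            exact (hle S k hN).trans (lintegral_armLik_le_one _ _ _)
        _ ≤ _ := by
            rw [mul_one]
            exact ofReal_mul_pow_le hw.le hβ hβa S k
    · have h1 : S + k ≠ 0 := by omega
      have h2 : ¬ S + k ≤ P.n₀ := by omega
      have hone : ENNReal.ofReal (w * (β / 4)) * ENNReal.ofReal (β / 4) ^ T ≤ 1 := by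
        refine mul_le_one' ?_ (pow_le_one' hβ1 _)
        rw [ENNReal.ofReal_le_one]
        nlinarith
      refine (mul_le_mul' hone le_rfl).trans ?_
      rw [one_mul]
      simp only [subsol, h1, h2, if_false]
      by_cases hne : P.main S k = 0
      · simp [hne]
      refine (ENNReal.ofReal_le_ofReal (hmain S k (by omega) hN)).trans ?_
      have hlt := hlowβ S k hm.le hne
      exact ofReal_mul_uniformMix_le (α := α) ha hw.le (S := S) (k := k) (by omega)
        (hlow S k (by omega) hne).le (s := {x : I | (x : ℝ) < β})
        fun x hx => lt_of_le_of_lt hx hlt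

end Params

/-! ### The choice of parameters -/

lemma eventually_mul_pow_le_exp (C : ℝ) (k : ℕ) {r : ℝ} (hr : 0 < r) :
    ∀ᶠ x : ℝ in atTop, C * x ^ k ≤ Real.exp (r * x) := by
  have h := (isLittleO_pow_exp_pos_mul_atTop (k := k) hr).const_mul_left C
  filter_upwards [h.bound one_pos] with x hx
  rw [one_mul, Real.norm_eq_abs, Real.norm_eq_abs, abs_of_pos (Real.exp_pos _)] at hx
  exact (le_abs_self _).trans hx

/-- The parameters used for `N` samples, in terms of `x = log N`. -/
def paramsOf (lam L d' a w x : ℝ) : Params where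
  lam := lam
  L := L
  -- With `x = log N` this `D` lets the boundary descend by at most `d'` up to time `N`. The powers
  -- below compare with the loss, of order `x⁻²`: the reservoir mass near `a` is `O(δ) = O(x⁻⁶)`,
  -- the Chebyshev error is `1/(n₀ δ²) ≤ x⁻⁸`, and `n₀ * loss`, of order `x¹⁸`, beats the `x` needed
  -- to pay for the prefactor.
  D := d' / x
  δ := 1 / x ^ 6
  Θ := angle (a - 1 / x ^ 6 / 2)
  c := w / (4 * Real.exp x)
  n₀ := ⌈x ^ 20⌉₊

/-- The sample size beyond which an arm has to look bad. -/
def lateTime (x : ℝ) : ℕ := ⌈Real.exp x / x ^ 3⌉₊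

lemma loss_paramsOf (lam L d' a w x : ℝ) :
    (paramsOf lam L d' a w x).loss = (1 + lam) * d' ^ 2 / 2 / x ^ 2 := by
  simp only [Params.loss, paramsOf, div_pow]; ring

-- The two conditions on `d'` pull in opposite directions: `hlα` keeps the boundary above `angle l`
-- up to time `N`, so that `exists_urn_step` applies throughout, and `hgap` takes it below `angle
-- β'` already by `lateTime x`.
set_option maxHeartbeats 1000000 in
theorem eventually_le_failureProb {α a : I} {lam L l w β β' d' : ℝ}
    (hlam : 0 < lam) (hlam1 : lam < 1) (hL : 0 ≤ L)
    (hτ : 8 * Real.exp (-(lam / 2 * L ^ 2 / 2)) ≤ lam * Real.exp (-(9 / lam)))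
    (hw : 0 < w) (hw1 : w < 1) (hα : (0 : ℝ) < α) (hαa : (α : ℝ) < a) (ha1 : (a : ℝ) < 1)
    (hβ : 0 < β) (hβa : β < a) (hβ' : β' < β) (hl : 0 < l) (hla : l ≤ a)
    (hd' : 0 < d') (hlα : angle l ≤ angle α - d') (hgap : angle a - angle β' < d') :
    ∀ᶠ x : ℝ in atTop, ∀ N : ℕ, (N : ℝ) = Real.exp x → ∀ A : Algorithm,
      ENNReal.ofReal (w * (β / 4)) * ENNReal.ofReal (β / 4) ^ lateTime x *
        ENNReal.ofReal (1 - (1 + lam) * d' ^ 2 / 2 / x ^ 2) ^ N ≤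
      failureProb (reservoir α a w) A N β := by
  have ha : (0 : ℝ) < a := hβ.trans hβa
  obtain ⟨ν, hν, hstep⟩ := exists_urn_step hlam hlam1 hL hl hla
    (show (a : ℝ) < (1 + a) / 2 by linarith) (by linarith) hτ
  set R := (1 + lam) * d' ^ 2 / 2 with hR
  have hRpos : 0 < R := by positivity
  set τ := Real.exp (-(lam / 2 * L ^ 2 / 2)) with hτdef
  have hτ1 : 0 < 1 - τ := by
    have : Real.exp (-(9 / lam)) ≤ 1 := by
      rw [Real.exp_le_one_iff]; have : 0 < 9 / lam := by positivity
      linarith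
    nlinarith
  set g := d' - (angle a - angle β') with hg
  have hgpos : 0 < g := by linarith
  set r := g / 2 / d' with hr
  have hrpos : 0 < r := by positivity
  have haα : 0 < (a : ℝ) - α := by linarith
  have hββ : 0 < β - β' := by linarith
  filter_upwards [eventually_ge_atTop 8, eventually_ge_atTop (2 / ((a : ℝ) - α)),
    eventually_ge_atTop (2 * (2 * w / a + 1) / R), eventually_ge_atTop (2 * L / d'),
    eventually_ge_atTop (1 / g), eventually_ge_atTop (2 / (β - β')), eventually_ge_atTop (d' / ν),
    eventually_ge_atTop R, eventually_ge_atTop (1 / (ν * d' ^ 2)), eventually_ge_atTop (6 / R),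
    eventually_ge_atTop (4 / (w * (1 - τ))), eventually_mul_pow_le_exp 3 20 one_pos,
    eventually_mul_pow_le_exp 2 23 one_pos, eventually_mul_pow_le_exp 4 23 hrpos] with
    x hx8 hx2 hx3 hx5 hxg hxβ hxν hxR hxν2 hx6 hxw hexp20 hexp23 hexpr N hN A
  have hx0 : 0 < x := by linarith
  have hx1 : 1 ≤ x := by linarith
  rw [one_mul] at hexp20 hexp23
  have hpow : ∀ k : ℕ, 1 ≤ k → x ≤ x ^ k := fun k hk => le_self_pow₀ hx1 (by omega)
  set P := paramsOf lam L d' a w x with hPdef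
  have hloss : P.loss = R / x ^ 2 := loss_paramsOf ..
  have hn₀l : x ^ 20 ≤ (P.n₀ : ℝ) := Nat.le_ceil _
  have hn₀u : (P.n₀ : ℝ) < x ^ 20 + 1 := Nat.ceil_lt_add_one (by positivity)
  have hTl : Real.exp x / x ^ 3 ≤ (lateTime x : ℝ) := Nat.le_ceil _
  have hn₀pos : 0 < P.n₀ := by
    have : (0 : ℝ) < P.n₀ := lt_of_lt_of_le (by positivity) hn₀l
    exact_mod_cast this
  have hδ : P.δ = 1 / x ^ 6 := rfl
  have hD : P.D = d' / x := rfl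
  have hδx : P.δ ≤ 1 / x := by rw [hδ]; gcongr; exact hpow 6 (by norm_num)
  have hδpos : 0 < P.δ := by rw [hδ]; positivity
  have hDpos : 0 < P.D := by rw [hD]; positivity
  have hT : P.n₀ ≤ lateTime x := by
    have h1 : x ^ 20 + 1 ≤ Real.exp x / x ^ 3 := by
      rw [le_div_iff₀ (by positivity)]
      have : x ^ 3 ≤ x ^ 23 := pow_le_pow_right₀ hx1 (by norm_num)
      calc (x ^ 20 + 1) * x ^ 3 = x ^ 23 + x ^ 3 := by ring
        _ ≤ 2 * x ^ 23 := by linarith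
        _ ≤ _ := hexp23
    have h2 : (P.n₀ : ℝ) ≤ lateTime x := by linarith
    exact_mod_cast h2
  have hTR : (P.n₀ : ℝ) ≤ lateTime x := by exact_mod_cast hT
  have hδ2 : α ≤ (a : ℝ) - 2 * P.δ := by
    have : 2 * (1 / x) ≤ a - α := by
      rw [div_le_iff₀ haα] at hx2
      rw [mul_one_div, div_le_iff₀ hx0]; linarith
    linarith
  have hloss1 : P.loss ≤ 1 := by
    rw [hloss, div_le_one (by positivity)]
    exact hxR.trans (hpow 2 (by norm_num))
  have hNpos : (0 : ℝ) < N := hN ▸ Real.exp_pos x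
  have hN1 : (1 : ℝ) ≤ N := by
    have : 0 < N := by exact_mod_cast hNpos
    exact_mod_cast this
  have hLδ : P.L / (P.D * (P.n₀ + 2)) ≤ P.δ / 2 := by
    have hLL : P.L = L := rfl
    rw [hLL, hD, hδ]
    calc L / (d' / x * (P.n₀ + 2)) ≤ L / (d' / x * x ^ 20) := by gcongr; linarith
      _ = L / d' / x ^ 19 := by field_simp
      _ ≤ (x ^ 13 / 2) / x ^ 19 := by
        refine div_le_div_of_nonneg_right ?_ (by positivity)
        have h13 := hpow 13 (by norm_num)
        have : 2 * L / d' = 2 * (L / d') := by ring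
        rw [this] at hx5
        linarith
      _ = 1 / x ^ 6 / 2 := by field_simp
  have hΘ : P.Θ = angle (a - P.δ / 2) := rfl
  have hvalid : P.Valid N l a ν := by
    refine ⟨hlam, hL, hDpos, hδpos, ?_, hn₀pos, hloss1, ?_, ?_, hν, ?_, ?_, ?_⟩
    · change 0 ≤ w / (4 * Real.exp x); positivity
    · have hDν : P.D ≤ ν := by
        rw [hD, div_le_iff₀ hx0]
        rwa [div_le_iff₀ hν, mul_comm] at hxν
      exact hstep P.D hDpos hDν
    · rw [hD]
      rw [div_le_iff₀ (by positivity)] at hxν2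
      calc (1 : ℝ) ≤ x * (ν * d' ^ 2) := hxν2
        _ ≤ x ^ 18 * (ν * d' ^ 2) := by gcongr; exact hpow 18 (by norm_num)
        _ = ν * (d' / x) ^ 2 * x ^ 20 := by field_simp
        _ ≤ _ := by gcongr
    · have hΘα : angle α ≤ P.Θ := by rw [hΘ]; exact angle_mono (by linarith)
      have hlog : Real.log ((N + 2) / (P.n₀ + 2)) ≤ x := by
        rw [← Real.log_exp x, ← hN]
        refine Real.log_le_log (by positivity) ?_
        rw [div_le_iff₀ (by positivity)]
        have : (1 : ℝ) ≤ P.n₀ := by exact_mod_cast hn₀pos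
        calc (N + 2 : ℝ) ≤ N * (1 + 2) := by linarith only [hN1]
          _ ≤ N * (P.n₀ + 2) := by gcongr
      have : P.D * Real.log ((N + 2) / (P.n₀ + 2)) ≤ d' := by
        calc _ ≤ P.D * x := by gcongr
          _ = d' := by rw [hD]; field_simp
      unfold Params.boundary
      linarith
    · rw [hΘ]; exact angle_mono (by linarith)
    · change (1 - P.loss / 2) ^ P.n₀ * (P.n₀ + 1) ≤ w / (4 * Real.exp x) * (1 - τ)
      have h1 : (1 - P.loss / 2) ^ P.n₀ ≤ Real.exp (-(3 * x)) := by
        calc (1 - P.loss / 2) ^ P.n₀ ≤ Real.exp (-(P.loss / 2)) ^ P.n₀ := by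
              refine pow_le_pow_left₀ (by linarith) ?_ _
              have := Real.add_one_le_exp (-(P.loss / 2))
              linarith
          _ = Real.exp (-(P.n₀ * (P.loss / 2))) := by rw [← Real.exp_nat_mul]; congr 1; ring
          _ ≤ _ := by
            rw [Real.exp_le_exp, neg_le_neg_iff, hloss]
            rw [div_le_iff₀ hRpos] at hx6
            calc 3 * x = x * 6 / 2 := by ring
              _ ≤ x * (x * R) / 2 := by gcongr
              _ = x ^ 2 * (R / 2) := by ring
              _ ≤ x ^ 18 * (R / 2) := by gcongr; norm_num
              _ = x ^ 20 * (R / x ^ 2 / 2) := by field_simp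
              _ ≤ _ := by gcongr
      have h2 : (P.n₀ + 1 : ℝ) ≤ Real.exp x := by
        have : 1 ≤ x ^ 20 := one_le_pow₀ hx1
        linarith
      have h3 : Real.exp (-x) ≤ w * (1 - τ) / 4 := by
        rw [div_le_iff₀ (by positivity)] at hxw
        have h5 : x ≤ Real.exp x := by have := Real.add_one_le_exp x; linarith
        have h6 : Real.exp (-x) * Real.exp x = 1 := by rw [← Real.exp_add]; simp
        have h7 : Real.exp (-x) * x ≤ 1 := by
          rw [← h6]; gcongr
        have h8 := mul_le_mul_of_nonneg_left hxw (Real.exp_pos (-x)).le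
        have h9 : Real.exp (-x) * x * (w * (1 - τ)) ≤ 1 * (w * (1 - τ)) := by gcongr
        linarith only [h8, h9]
      calc (1 - P.loss / 2) ^ P.n₀ * (P.n₀ + 1) ≤ Real.exp (-(3 * x)) * Real.exp x := by gcongr
        _ = Real.exp (-x) * Real.exp (-x) := by rw [← Real.exp_add, ← Real.exp_add]; congr 1; ring
        _ ≤ (w * (1 - τ) / 4) * Real.exp (-x) := by gcongr
        _ = _ := by rw [Real.exp_neg]; field_simp
  have hV : w / a * (2 * P.δ) + 1 / (P.n₀ * P.δ ^ 2) ≤ P.loss / 2 := by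
    rw [hloss, hδ]
    rw [div_le_iff₀ hRpos] at hx3
    calc w / a * (2 * (1 / x ^ 6)) + 1 / (P.n₀ * (1 / x ^ 6) ^ 2)
        ≤ w / a * (2 * (1 / x ^ 3)) + 1 / (x ^ 20 * (1 / x ^ 6) ^ 2) := by
          gcongr
          norm_num
      _ = w / a * (2 * (1 / x ^ 3)) + 1 / x ^ 8 := by field_simp
      _ ≤ w / a * (2 * (1 / x ^ 3)) + 1 / x ^ 3 := by
          gcongr
          norm_num
      _ = (2 * w / a + 1) / x ^ 3 := by ring
      _ ≤ (x * R / 2) / x ^ 3 := by gcongr; linarith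
      _ = R / x ^ 2 / 2 := by field_simp
  have hδn : 8 ≤ P.δ * P.n₀ := by
    rw [hδ]
    calc 8 ≤ x := hx8
      _ ≤ x ^ 14 := hpow 14 (by norm_num)
      _ = 1 / x ^ 6 * x ^ 20 := by field_simp
      _ ≤ _ := by gcongr
  have hTβ : P.boundary (lateTime x + 2) + P.L / (P.D * (lateTime x + 2)) ≤ angle β' := by
    have h1 : P.L / (P.D * (lateTime x + 2)) ≤ g / 2 := by
      have hLL : 0 ≤ P.L := hL
      calc _ ≤ P.L / (P.D * (P.n₀ + 2)) := by gcongr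
        _ ≤ P.δ / 2 := hLδ
        _ ≤ 1 / x / 2 := by gcongr
        _ ≤ g / 2 := by
          rw [div_le_iff₀ hgpos] at hxg
          have : 1 / x ≤ g := by rw [div_le_iff₀ hx0]; linarith
          linarith
    -- Both `n₀` and `exp x / lateTime x` are polynomial in `x`, so stopping at `lateTime x` instead
    -- of `N` and starting at `n₀` costs only a small fraction `r` of the logarithmic time.
    have h2 : (1 - r) * x ≤ Real.log ((lateTime x + 2) / (P.n₀ + 2)) := by
      rw [Real.le_log_iff_exp_le (by positivity), le_div_iff₀ (by positivity)]
      have h20 : 1 ≤ x ^ 20 := one_le_pow₀ hx1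
      have hden : (P.n₀ + 2 : ℝ) ≤ 4 * x ^ 20 := by linarith
      calc Real.exp ((1 - r) * x) * (P.n₀ + 2) ≤ Real.exp ((1 - r) * x) * (4 * x ^ 20) := by gcongr
        _ = Real.exp ((1 - r) * x) * (4 * x ^ 23) / x ^ 3 := by field_simp
        _ ≤ Real.exp ((1 - r) * x) * Real.exp (r * x) / x ^ 3 := by gcongr
        _ = Real.exp x / x ^ 3 := by rw [← Real.exp_add]; congr 2; ring
        _ ≤ lateTime x + 2 := by linarith
    have h3 : d' - g / 2 ≤ P.D * Real.log ((lateTime x + 2) / (P.n₀ + 2)) := by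
      calc d' - g / 2 = P.D * ((1 - r) * x) := by rw [hD, hr]; field_simp
        _ ≤ _ := by gcongr
    have h4 : P.Θ ≤ angle a := by rw [hΘ]; exact angle_mono (by linarith)
    unfold Params.boundary
    linarith
  have hTβ' : 2 ≤ (β - β') * lateTime x := by
    rw [div_le_iff₀ hββ] at hxβ
    calc (2 : ℝ) ≤ (β - β') * x := by linarith
      _ ≤ (β - β') * lateTime x := by
        gcongr
        exact (hpow 20 (by norm_num)).trans (hn₀l.trans hTR)
  have hc : P.c * (4 * N) ≤ w := by
    change w / (4 * Real.exp x) * (4 * N) ≤ w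
    rw [hN]
    have := Real.exp_pos x
    exact le_of_eq (by field_simp)
  have := hvalid.le_failureProb hw hw1 hα ha1 hβ hβa hβ' hc hδ2 hV hΘ hδn hLδ hT hTβ hTβ' A
  rwa [hloss] at this

/-! ### Asymptotics -/

lemma rateConstant_eq_fisherDist {α β : ℝ} (hβ : 0 < β) (hβα : β < α) (hα : α < 1) :
    rateConstant α β = fisherDist α β ^ 2 / 2 := by
  have hin : ∀ x ∈ Set.uIcc α β, 0 < x ∧ x < 1 := by
    intro x hx
    rw [Set.uIcc_of_ge hβα.le] at hx
    exact ⟨hβ.trans_le hx.1, hx.2.trans_lt hα⟩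
  have hint : IntervalIntegrable (fun x : ℝ => 1 / Real.sqrt (x * (1 - x))) volume α β := by
    refine ContinuousOn.intervalIntegrable (ContinuousOn.div (by fun_prop) (by fun_prop) ?_)
    intro x hx
    exact (bernoulliSD_pos (hin x hx).1 (hin x hx).2).ne'
  have h := intervalIntegral.integral_eq_sub_of_hasDerivAt (a := α) (b := β) (f := angle)
    (fun x hx => hasDerivAt_angle (hin x hx).1 (hin x hx).2) hint
  rw [fisherDist, show (∫ x in α..β, 1 / Real.sqrt (x * (1 - x))) = angle β - angle α from h,
    sq_abs, rateConstant, angle, angle]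
  ring

/-- With `N = exp x`, the cost of `lateTime x ≈ N/x³` becomes `O(1/x)` after multiplication by
`x²/N`, and only the loss of the `N` samples survives, with limit `R`. The quotient `κ/(1-κ)` comes
from `-log (1-κ) ≤ κ/(1-κ)`. -/
lemma eventually_rate_le {C₀ C₁ R B : ℝ} (hC₁ : 0 ≤ C₁) (hB : R < B) :
    ∀ᶠ x : ℝ in atTop, R / x ^ 2 < 1 ∧
      (C₀ + C₁ * lateTime x + Real.exp x * (R / x ^ 2 / (1 - R / x ^ 2))) *
        (x ^ 2 / Real.exp x) ≤ B := by
  have h1 : Tendsto (fun x : ℝ => x ^ 2 * Real.exp (-x)) atTop (nhds 0) :=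
    Real.tendsto_pow_mul_exp_neg_atTop_nhds_zero 2
  have h2 : Tendsto (fun x : ℝ => x⁻¹) atTop (nhds 0) := tendsto_inv_atTop_zero
  have h3 : Tendsto (fun x : ℝ => R / x ^ 2) atTop (nhds 0) :=
    tendsto_const_nhds.div_atTop (tendsto_pow_atTop two_ne_zero)
  have h4 : Tendsto (fun x : ℝ => C₀ * (x ^ 2 * Real.exp (-x)) +
      C₁ * (x⁻¹ + x ^ 2 * Real.exp (-x)) + R / (1 - R / x ^ 2)) atTop
      (nhds (C₀ * 0 + C₁ * (0 + 0) + R / (1 - 0))) :=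
    ((h1.const_mul C₀).add ((h2.add h1).const_mul C₁)).add
      (tendsto_const_nhds.div (tendsto_const_nhds.sub h3) (by norm_num))
  have h5 : C₀ * 0 + C₁ * (0 + 0) + R / (1 - 0) < B := by simpa using hB
  filter_upwards [h4.eventually_lt_const h5, h3.eventually_lt_const one_pos,
    eventually_gt_atTop 0] with x hx hx1 hx0
  refine ⟨hx1, le_trans ?_ hx.le⟩
  have hT : (lateTime x : ℝ) ≤ Real.exp x / x ^ 3 + 1 := (Nat.ceil_lt_add_one (by positivity)).le
  have hexp := Real.exp_pos x
  have hne : 1 - R / x ^ 2 ≠ 0 := by linarith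
  calc _ ≤ (C₀ + C₁ * (Real.exp x / x ^ 3 + 1) +
        Real.exp x * (R / x ^ 2 / (1 - R / x ^ 2))) * (x ^ 2 / Real.exp x) := by gcongr
    _ = _ := by
      rw [Real.exp_neg]
      generalize 1 - R / x ^ 2 = z at hne
      field_simp

lemma neg_log_mul_le {y : ℝ≥0∞} {X c B : ℝ} (hX : 0 < X) (hy : ENNReal.ofReal X ≤ y) (hc : 0 ≤ c)
    (h : -Real.log X * c ≤ B) : -ENNReal.log y * (c : EReal) ≤ (B : EReal) := by
  have h1 : -ENNReal.log y ≤ ((-Real.log X : ℝ) : EReal) := by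
    rw [EReal.coe_neg, EReal.neg_le_neg_iff, ← ENNReal.log_ofReal_of_pos hX]
    exact ENNReal.log_le_log hy
  calc -ENNReal.log y * (c : EReal) ≤ ((-Real.log X : ℝ) : EReal) * (c : EReal) :=
        mul_le_mul_of_nonneg_right h1 (EReal.coe_nonneg.mpr hc)
    _ = ((-Real.log X * c : ℝ) : EReal) := (EReal.coe_mul _ _).symm
    _ ≤ _ := EReal.coe_le_coe_iff.mpr h

lemma neg_log_le {K b κ : ℝ} (hK : 0 < K) (hb : 0 < b) (hκ : κ < 1) (T N : ℕ) :
    -Real.log (K * b ^ T * (1 - κ) ^ N) ≤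
      -Real.log K + -Real.log b * T + N * (κ / (1 - κ)) := by
  have h1 : 0 < 1 - κ := by linarith
  rw [Real.log_mul (by positivity) (by positivity), Real.log_mul (by positivity) (by positivity),
    Real.log_pow, Real.log_pow]
  have h2 : -(κ / (1 - κ)) ≤ Real.log (1 - κ) := by
    have := Real.one_sub_inv_le_log_of_pos h1
    refine le_trans (le_of_eq ?_) this
    field_simp; ring
  have h3 := mul_le_mul_of_nonneg_left h2 (Nat.cast_nonneg (α := ℝ) N)
  linarith

theorem eventually_neg_log_failureProb_le {α a : I} {lam L l w β β' d' B : ℝ}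
    (hlam : 0 < lam) (hlam1 : lam < 1) (hL : 0 ≤ L)
    (hτ : 8 * Real.exp (-(lam / 2 * L ^ 2 / 2)) ≤ lam * Real.exp (-(9 / lam)))
    (hw : 0 < w) (hw1 : w < 1) (hα : (0 : ℝ) < α) (hαa : (α : ℝ) < a) (ha1 : (a : ℝ) < 1)
    (hβ : 0 < β) (hβa : β < a) (hβ' : β' < β) (hl : 0 < l) (hla : l ≤ a)
    (hd' : 0 < d') (hlα : angle l ≤ angle α - d') (hgap : angle a - angle β' < d')
    (hB : (1 + lam) * d' ^ 2 / 2 < B) :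
    ∀ᶠ N : ℕ in atTop, ∀ A : Algorithm,
      -ENNReal.log (failureProb (reservoir α a w) A N β) *
        ((Real.log N ^ 2 / N : ℝ) : EReal) ≤ (B : EReal) := by
  have hlog : Tendsto (fun N : ℕ => Real.log N) atTop atTop :=
    Real.tendsto_log_atTop.comp tendsto_natCast_atTop_atTop
  have hb1 : 0 ≤ -Real.log (β / 4) := by
    have := Real.log_nonpos (x := β / 4) (by positivity) (by linarith)
    linarith
  have h1 := hlog.eventually (eventually_le_failureProb hlam hlam1 hL hτ hw hw1 hα hαa ha1 hβ hβa
    hβ' hl hla hd' hlα hgap)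
  have h2 := hlog.eventually (eventually_rate_le (C₀ := -Real.log (w * (β / 4))) hb1 hB)
  filter_upwards [h1, h2, eventually_gt_atTop 0] with N hN1 hN2 hN0 A
  have hN0' : (0 : ℝ) < N := by exact_mod_cast hN0
  have hexp : Real.exp (Real.log N) = N := Real.exp_log hN0'
  obtain ⟨hκ, hrate⟩ := hN2
  have hf := hN1 N hexp.symm A
  rw [hexp] at hrate
  set κ := (1 + lam) * d' ^ 2 / 2 / Real.log N ^ 2
  have hκ' : 0 < 1 - κ := by linarith
  rw [← ENNReal.ofReal_pow (by positivity), ← ENNReal.ofReal_pow hκ'.le,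
    ← ENNReal.ofReal_mul (by positivity), ← ENNReal.ofReal_mul (by positivity)] at hf
  refine neg_log_mul_le (by positivity) hf (by positivity) (le_trans ?_ hrate)
  gcongr
  exact neg_log_le (by positivity) (by positivity) hκ _ _

end InfiniteBandit

end

/-! ### Choice of the constants and conclusion -/

open InfiniteBandit in
theorem mainTheorem1 (lam η α β : ℝ) (hlam : 0 < lam) (hlam' : lam < 1)
    (hη : 0 < η) (hη' : η < 1) (hβ : 0 < β) (hβα : β < α) (hα : α < 1) :
    InfiniteBandit.rateConstant α β = InfiniteBandit.fisherDist α β ^ 2 / 2 ∧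
    ∃ μ : Measure I, IsProbabilityMeasure μ ∧
      InfiniteBandit.reservoirQuantile μ (1 - η) = α ∧
      ∀ A : ℕ → InfiniteBandit.Algorithm,
        liminf
          (fun N : ℕ =>
            -ENNReal.log (InfiniteBandit.failureProb μ (A N) N β) *
              ((Real.log N ^ 2 / N : ℝ) : EReal))
          atTop
        ≤ ((InfiniteBandit.rateConstant α β + lam : ℝ) : EReal) := by
  refine ⟨rateConstant_eq_fisherDist hβ hβα hα, ?_⟩
  have hα0 : 0 < α := hβ.trans hβα
  have hrate : rateConstant α β = (angle α - angle β) ^ 2 / 2 := rfl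
  set d := angle α - angle β with hd
  have hdpos : 0 < d := sub_pos.mpr (angle_lt_angle hβ.le hβα hα.le)
  have hβpos : 0 < angle β := by
    rw [← angle_zero]; exact angle_lt_angle le_rfl hβ (hβα.trans hα).le
  -- The excess `d' - d` is split evenly between `a > α` and `β' < β`. The bound `d' < angle α`
  -- keeps the lowest boundary angle positive, hence `l > 0`.
  obtain ⟨d', ⟨hd'α, hd'B⟩, hdd'⟩ : ∃ d', (d' < angle α ∧ d' ^ 2 / 2 < d ^ 2 / 2 + lam) ∧ d < d' := by
    have h1 : ∀ᶠ x in nhdsWithin d (Set.Ioi d), x < angle α :=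
      nhdsWithin_le_nhds (eventually_lt_nhds (by linarith))
    have h2 : ∀ᶠ x in nhdsWithin d (Set.Ioi d), x ^ 2 / 2 < d ^ 2 / 2 + lam := by
      have hc : ContinuousAt (fun x : ℝ => x ^ 2 / 2) d := by fun_prop
      exact nhdsWithin_le_nhds (hc.eventually_lt_const (by linarith))
    exact ((h1.and h2).and self_mem_nhdsWithin).exists
  have hd'pos : 0 < d' := hdpos.trans hdd'
  obtain ⟨ε, ⟨hεB, hε1⟩, hε0⟩ :
      ∃ ε : ℝ, ((1 + ε) * d' ^ 2 / 2 < d ^ 2 / 2 + lam ∧ ε < 1) ∧ 0 < ε := by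
    have h1 : ∀ᶠ x in nhdsWithin (0 : ℝ) (Set.Ioi 0), (1 + x) * d' ^ 2 / 2 < d ^ 2 / 2 + lam := by
      have hc : ContinuousAt (fun x : ℝ => (1 + x) * d' ^ 2 / 2) 0 := by fun_prop
      exact nhdsWithin_le_nhds (hc.eventually_lt_const (by simpa using hd'B))
    have h2 : ∀ᶠ x in nhdsWithin (0 : ℝ) (Set.Ioi 0), x < 1 :=
      nhdsWithin_le_nhds (eventually_lt_nhds one_pos)
    exact ((h1.and h2).and self_mem_nhdsWithin).exists
  obtain ⟨a, ⟨haα, ha1⟩, hαa⟩ : ∃ a, (angle a < angle α + (d' - d) / 2 ∧ a < 1) ∧ α < a := by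
    have h1 : ∀ᶠ x in nhdsWithin α (Set.Ioi α), angle x < angle α + (d' - d) / 2 :=
      nhdsWithin_le_nhds (continuous_angle.continuousAt.eventually_lt_const (by linarith))
    have h2 : ∀ᶠ x in nhdsWithin α (Set.Ioi α), x < 1 :=
      nhdsWithin_le_nhds (eventually_lt_nhds hα)
    exact ((h1.and h2).and self_mem_nhdsWithin).exists
  obtain ⟨β', hβ'1, hβ'β⟩ : ∃ β', angle β - (d' - d) / 2 < angle β' ∧ β' < β := by
    have h1 : ∀ᶠ x in nhdsWithin β (Set.Iio β), angle β - (d' - d) / 2 < angle x :=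
      nhdsWithin_le_nhds (continuous_angle.continuousAt.eventually_const_lt (by linarith))
    exact (h1.and self_mem_nhdsWithin).exists
  have ha0 : 0 < a := hα0.trans hαa
  obtain ⟨L, hτ, hL⟩ : ∃ L : ℝ,
      8 * Real.exp (-(ε / 2 * L ^ 2 / 2)) ≤ ε * Real.exp (-(9 / ε)) ∧ 0 ≤ L := by
    have h1 : Tendsto (fun L : ℝ => ε / 2 * L ^ 2 / 2) atTop atTop :=
      ((tendsto_pow_atTop two_ne_zero).const_mul_atTop (by positivity)).atTop_div_const two_pos
    have h2 : Tendsto (fun L : ℝ => 8 * Real.exp (-(ε / 2 * L ^ 2 / 2))) atTop (nhds (8 * 0)) :=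
      (Real.tendsto_exp_neg_atTop_nhds_zero.comp h1).const_mul 8
    rw [mul_zero] at h2
    exact ((h2.eventually_le_const (by positivity)).and (eventually_ge_atTop 0)).exists
  set l := (1 - Real.cos (angle α - d')) / 2 with hl
  have hangl : angle l = angle α - d' :=
    angle_half_one_sub_cos (by linarith)
      ((sub_le_self _ hd'pos.le).trans (Real.arccos_le_pi (1 - 2 * α)))
  have hl0 : 0 < l := by
    by_contra h
    push Not at h
    have := angle_mono h
    rw [hangl, angle_zero] at this
    linarith
  have hla : l ≤ a := by
    by_contra h
    push Not at h
    have h1 := angle_mono h.le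
    have h2 := angle_mono hαa.le
    rw [hangl] at h1
    linarith
  set αI : I := ⟨α, hα0.le, hα.le⟩
  set aI : I := ⟨a, ha0.le, ha1.le⟩
  set w := min η (1 - η) with hw
  have hw0 : 0 < w := lt_min hη (by linarith)
  have hw1 : w < 1 := (min_le_left _ _).trans_lt hη'
  refine ⟨reservoir αI aI w, isProbabilityMeasure_reservoir ha0 hw0 hw1,
    reservoirQuantile_reservoir (α := αI) (a := aI) hα0 (Subtype.coe_lt_coe.mp hαa) hw0 hw1
      (min_le_left _ _) (min_le_right _ _), fun A => ?_⟩
  have hev := eventually_neg_log_failureProb_le (α := αI) (a := aI) hε0 hε1 hL hτ hw0 hw1 hα0 hαa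
    ha1 hβ (hβα.trans hαa) hβ'β hl0 hla hd'pos hangl.le
    (show angle a - angle β' < d' by linarith) (B := rateConstant α β + lam) (by rw [hrate]; exact hεB)
  refine liminf_le_of_frequently_le' (Eventually.frequently ?_)
  filter_upwards [hev] with N hN
  exact hN (A N)
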